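/- **Proposition (consistency in coNP).** A signature $\mathcal F$ is a finite set of function symbols with arities, and trees over $\mathcal F$ are ground terms over $\mathcal F$. A term rewriting system (TRS) $\mathcal R$ over $\mathcal F$ is a finite set of rules $l \to r$, where $l, r$ are arbitrary terms over $\mathcal F$ with variables from $\{X_1, X_2, \ldots\}$; $\rightarrow^*_{\mathcal R}$ is the reflexive and transitive closure of its single-step rewrite relation. A bottom-up deterministic finite tree automaton (DFTA) $\mathcal A$ over $\mathcal F$ consists of a finite set of states $Q$, a set of accepting states, and transitions assigning to every symbol $f \in \mathcal F$ of arity $k$ and every tuple in $Q^k$ a state; $\mathcal L(\mathcal A)$ is the set of trees that $\mathcal A$ evaluates to an accepting state. The TRS $\mathcal R$ is *consistent* with $\mathcal L(\mathcal A)$ if for all trees $s, t$ over $\mathcal F$ with $s \rightarrow^*_{\mathcal R} t$ we have $s \in \mathcal L(\mathcal A) \iff t \in \mathcal L(\mathcal A)$. Consider the following decision problem. The input is a signature $\mathcal F$, a DFTA $\mathcal A$ over $\mathcal F$ (with its states and its whole transition table listed) and a TRS $\mathcal R$ over $\mathcal F$ (with its rules listed), written as a word over a finite alphabet, with numbers in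 binary. The question is whether $\mathcal R$ is consistent with $\mathcal L(\mathcal A)$. 1. This problem is in $\mathsf{coNP}$. 2. For every fixed $N > 0$, the problem is decidable in polynomial time on inputs whose TRS has at most $N$ variables, i.e., such that in every rule $l \to r$ of $\mathcal R$ both terms $l, r$ are over the variables $\{X_1, \ldots, X_N\}$. -/

import Mathlib

namespace TreeRewriting

/-- A finite signature: finitely many function symbols, each with an arity. -/
structure Signature where
  numSymbols : ℕ
  arity : Fin numSymbols → ℕ

/-- Terms over the signature `S` with variables from `V`. Constants are symbols of arity `0`. -/
inductive Term (S : Signature) (V : Type) : Type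
  | var (x : V) : Term S V
  | app (f : Fin S.numSymbols) (ts : Fin (S.arity f) → Term S V) : Term S V

/-- Simultaneous substitution of terms for variables. -/
def Term.subst {S : Signature} {V W : Type} (σ : V → Term S W) : Term S V → Term S W
  | .var x => σ x
  | .app f ts => .app f fun i => (ts i).subst σ

/-- The set of variables occurring in a term. -/
def Term.vars {S : Signature} {V : Type} : Term S V → Set V
  | .var x => {x}
  | .app _ ts => ⋃ i, (ts i).vars

/-- A (ranked) tree over `S` is a ground term over `S`. -/
abbrev Tree (S : Signature) : Type := Term S Empty

/-- A tree, regarded as a term with variables from `V` in which no variable occurs. -/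
def Tree.toTerm {S : Signature} (V : Type) (t : Tree S) : Term S V :=
  Term.subst (fun x : Empty => x.elim) t

/-- A bottom-up deterministic finite tree automaton over `S` with set of states `Q`. The
transition function is defined on a symbol and a tuple of states exactly when the length of the
tuple is the arity of the symbol. -/
structure DFTA (S : Signature) (Q : Type) where
  accepting : Q → Bool
  delta : (f : Fin S.numSymbols) → (Fin (S.arity f) → Q) → Q

/-- The state that the automaton reaches at the root of a tree. -/
def DFTA.run {S : Signature} {Q : Type} (A : DFTA S Q) : Tree S → Q
  | .app f ts => A.delta f fun i => A.run (ts i)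

/-- The tree language recognized by the automaton. -/
def DFTA.language {S : Signature} {Q : Type} (A : DFTA S Q) : Set (Tree S) :=
  {t | A.accepting (A.run t) = true}

/-- A rewrite rule `l → r` is an arbitrary pair `(l, r)` of terms; the variable `X_{i+1}` is
represented by the number `i`. -/
abbrev Rule (S : Signature) : Type := Term S ℕ × Term S ℕ

/-- A term rewriting system: a finite set of rules, presented by a list. -/
abbrev TRS (S : Signature) : Type := List (Rule S)

/-- The single-step rewrite relation on terms with variables. As only finitely many variables
occur in a rule, it makes no difference whether substitutions have a finite domain. -/
inductive Step {S : Signature} (R : TRS S) : Term S ℕ → Term S ℕ → Prop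
  | rule (l r : Term S ℕ) (h : (l, r) ∈ R) (σ : ℕ → Term S ℕ) :
      Step R (l.subst σ) (r.subst σ)
  | arg (f : Fin S.numSymbols) (ts : Fin (S.arity f) → Term S ℕ) (i : Fin (S.arity f))
      (t : Term S ℕ) (h : Step R (ts i) t) :
      Step R (.app f ts) (.app f (Function.update ts i t))

/-- `R` rewrites the term `s` to the term `t` in finitely many (possibly zero) steps. -/
def Rewrites {S : Signature} (R : TRS S) : Term S ℕ → Term S ℕ → Prop :=
  Relation.ReflTransGen (Step R)

/-- (Full) consistency of a term rewriting system with a tree language. -/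
def Consistent {S : Signature} (R : TRS S) (L : Set (Tree S)) : Prop :=
  ∀ s t : Tree S, Rewrites R (s.toTerm ℕ) (t.toTerm ℕ) → (s ∈ L ↔ t ∈ L)

/-! ### The decision problem -/

/-- An input of the consistency problem: a signature, and a DFTA and a TRS over it. The states of
the automaton are numbered. -/
structure Input where
  sig : Signature
  numStates : ℕ
  aut : DFTA sig (Fin numStates)
  trs : TRS sig

/-- The question: is the TRS consistent with the language of the DFTA? -/
def Input.IsConsistent (x : Input) : Prop := Consistent x.trs x.aut.language

/-- In every rule, both terms are over the variables `X_1, …, X_N`. -/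
def Input.VarsBounded (N : ℕ) (x : Input) : Prop :=
  ∀ ρ ∈ x.trs, ρ.1.vars ⊆ Set.Iio N ∧ ρ.2.vars ⊆ Set.Iio N

/-! ### Writing inputs as words over a finite alphabet -/

/-- The alphabet: binary digits, tags that announce what kind of number follows, a mark for
accepting states, and punctuation. -/
inductive Letter : Type
  | bit (b : Bool)
  | sym
  | arity
  | state
  | accept
  | var
  | arrow
  | close
  | sep
  deriving DecidableEq, Fintype

/-- A number in binary, least significant digit first. -/
def encodeNumber (n : ℕ) : List Letter := n.bits.map Letter.bit

/-- A list of words, concatenated. -/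
def encodeFamily {n : ℕ} (w : Fin n → List Letter) : List Letter := (List.ofFn w).flatten

def encodeSymbol {m : ℕ} (f : Fin m) : List Letter := .sym :: encodeNumber f

def encodeState {n : ℕ} (q : Fin n) : List Letter := .state :: encodeNumber q

/-- The function symbols with their arities. -/
def encodeSignature (S : Signature) : List Letter :=
  encodeFamily fun f => encodeSymbol f ++ .arity :: encodeNumber (S.arity f)

/-- The list of all states, with the accepting ones marked. -/
def encodeStates {S : Signature} {n : ℕ} (A : DFTA S (Fin n)) : List Letter :=
  encodeFamily fun q => encodeState q ++ if A.accepting q then [.accept] else []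

/-- The transition `f(q_1, …, q_k) → δ(q_1, …, q_k, f)`. -/
def encodeTransition {S : Signature} {n : ℕ} (A : DFTA S (Fin n)) (f : Fin S.numSymbols)
    (q : Fin (S.arity f) → Fin n) : List Letter :=
  encodeSymbol f ++ (encodeFamily fun i => encodeState (q i)) ++
    .arrow :: encodeState (A.delta f q) ++ [.close]

/-- The table of all transitions. The equivalence `finFunctionFinEquiv` enumerates, for a symbol
of arity `k`, the `n ^ k` tuples of states. -/
def encodeTransitions {S : Signature} {n : ℕ} (A : DFTA S (Fin n)) : List Letter :=
  encodeFamily fun f : Fin S.numSymbols =>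
    encodeFamily fun j : Fin (n ^ S.arity f) =>
      encodeTransition A f (finFunctionFinEquiv.symm j)

/-- A term, written as a bracketed expression. -/
def encodeTerm {S : Signature} : Term S ℕ → List Letter
  | .var x => .var :: encodeNumber x
  | .app f ts => encodeSymbol f ++ (encodeFamily fun i => encodeTerm (ts i)) ++ [.close]

def encodeRule {S : Signature} (ρ : Rule S) : List Letter :=
  encodeTerm ρ.1 ++ .arrow :: encodeTerm ρ.2 ++ [.close]

/-- The word that represents an input of the consistency problem. -/
def Input.encode (x : Input) : List Letter :=
  encodeSignature x.sig ++ .sep :: encodeStates x.aut ++ .sep :: encodeTransitions x.aut ++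
    .sep :: (x.trs.map encodeRule).flatten

/-! ### Complexity classes

A decision problem is a predicate on a type `α` of inputs, which are written as words by
`e : α → List Γ`. The machines are Mathlib's (multi-tape) Turing machines. -/

/-- The Boolean function `f` is computed by a Turing machine in time polynomial in the length of
the word representing its argument. -/
def PolyTime {α Γ : Type} (e : α → List Γ) (f : α → Bool) : Prop :=
  Nonempty (Turing.TM2ComputableInPolyTime e Computability.encodeBool f)

/-- The decision problem `p` is decidable in (deterministic) polynomial time. -/
def InP {α Γ : Type} (e : α → List Γ) (p : α → Prop) : Prop :=
  ∃ f : α → Bool, PolyTime e f ∧ ∀ a, p a ↔ f a = true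

/-- An input together with a certificate: the word of the input, followed by the certificate,
which is written in a disjoint alphabet. -/
def encodeWithCertificate {α Γ : Type} (e : α → List Γ) (x : α × List Bool) : List (Γ ⊕ Bool) :=
  (e x.1).map Sum.inl ++ x.2.map Sum.inr

/-- The decision problem `p` is in NP: its positive instances are those with a certificate of
polynomial length that is accepted by a polynomial-time verifier. -/
def InNP {α Γ : Type} (e : α → List Γ) (p : α → Prop) : Prop :=
  ∃ (V : α × List Bool → Bool) (c : Polynomial ℕ),
    PolyTime (encodeWithCertificate e) V ∧
      ∀ a, p a ↔ ∃ w : List Bool, w.length ≤ c.eval (e a).length ∧ V (a, w) = true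

/-- The decision problem `p` is in coNP: its complement is in NP. -/
def InCoNP {α Γ : Type} (e : α → List Γ) (p : α → Prop) : Prop :=
  InNP e fun a => ¬ p a

end TreeRewriting

/-!
Consistency of a term rewriting system `R` with the language of a deterministic tree automaton `A`
is decided on the level of states. Call a pair of states `(p, q)` derivable if it is in the least
relation that is closed under the function symbols (componentwise) and contains the values of the
two sides of each rule, for every assignment of states to the variables such that each state used is
reached on some tree, that is, such that its diagonal pair is derivable (`Derives`). A derivable
pair is realized by trees `s` and `t` such that `s` rewrites to `t` (`Derives.exists_trees`), so a
derivable pair of an accepting and a nonaccepting state refutes consistency. Conversely, if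
consistency fails, then already a single rewrite step changes acceptance, and such a step uses one
rule with one assignment of reachable states to its variables
(`exists_derives_of_not_consistent`). Hence the assignments that are allowed in the definition of
derivability may be restricted to any set that contains this one.

For given assignments, the derivable pairs are computed by a saturation of the set of all pairs
(`distinguishes_iff`), in time polynomial in the input and the list of assignments. For the first
part, a certificate of inconsistency is the one assignment needed; it is defined on the variables
that occur in the rules, so that its length is polynomial (`exists_certificate`). For the second
part, all assignments to `N` variables are used; their number is polynomial in the number of states
as `N` is fixed (`exists_mem_assignments`).

It remains to see that these algorithms run in polynomial time on Turing machines. A small language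
of structured programs on stacks of bits (`Prog`) is translated to Mathlib's multi-tape machines
with one machine step for each program step (`Run.steps`, `polyTime_of_run`). On top of this, `FP`
is the class of functions between types of finite objects, coded as binary trees, that are computed
by such programs in polynomial time. It is closed under composition, pairing, case distinction, and
iteration over lists with intermediate results of polynomial size (`FP.foldl`). The algorithms are
written as ordinary functions on lists, and membership in `FP` follows from these closure
properties.
-/

namespace TreeRewriting

open Turing

/-! ### Structured programs on stacks -/

/-- Structured programs that operate on bit stacks, which are numbered. `case r p` pops the stack
`r` and continues with the program for the symbol found there (`none` if the stack is empty);
`loop r p` pops the stack `r` and runs the program for the symbol found there until the stack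
is empty. -/
inductive Prog
  | skip
  | push (r : ℕ) (b : Bool)
  | seq (p q : Prog)
  | case (r : ℕ) (p : Option Bool → Prog)
  | loop (r : ℕ) (p : Bool → Prog)

namespace Prog

/-- All stacks that occur in the program have numbers less than `M`. -/
def Bounded (M : ℕ) : Prog → Prop
  | skip => True
  | push r _ => r < M
  | seq p q => p.Bounded M ∧ q.Bounded M
  | case r p => r < M ∧ ∀ o, (p o).Bounded M
  | loop r p => r < M ∧ ∀ b, (p b).Bounded M

theorem Bounded.mono {M N : ℕ} (h : M ≤ N) : ∀ {p : Prog}, p.Bounded M → p.Bounded N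
  | skip, _ => trivial
  | push _ _, hp => lt_of_lt_of_le hp h
  | seq _ _, hp => ⟨hp.1.mono h, hp.2.mono h⟩
  | case _ _, hp => ⟨hp.1.trans_le h, fun o => (hp.2 o).mono h⟩
  | loop _ _, hp => ⟨hp.1.trans_le h, fun b => (hp.2 b).mono h⟩

end Prog

open Function (update)

/-- `Run p s s' t`: started on the stacks `s`, the program `p` stops with the stacks `s'` after `t`
steps. -/
inductive Run : Prog → (ℕ → List Bool) → (ℕ → List Bool) → ℕ → Prop
  | skip (s) : Run .skip s s 1
  | push (s r b) : Run (.push r b) s (update s r (b :: s r)) 1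
  | seq {p q s s' s'' t t'} : Run p s s' t → Run q s' s'' t' → Run (.seq p q) s s'' (t + t')
  | case {r p s s' t} : Run (p (s r).head?) (update s r (s r).tail) s' t →
      Run (.case r p) s s' (t + 1)
  | loop_nil {r p s} : s r = [] → Run (.loop r p) s s 1
  | loop_cons {r p s s' s'' b u t t'} : s r = b :: u → Run (p b) (update s r u) s' t →
      Run (.loop r p) s' s'' t' → Run (.loop r p) s s'' (t + t' + 1)

/-! ### Translation of structured programs to Turing machines -/

namespace Prog

/-- The labels of the machine code for a structured program. -/
def Label : Prog → Type
  | skip => Unit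
  | push _ _ => Unit
  | seq p q => p.Label ⊕ q.Label
  | case _ p => Option (Σ o, (p o).Label)
  | loop _ p => Option (Σ b, (p b).Label)

theorem finite_label : ∀ p : Prog, Finite p.Label
  | skip => inferInstanceAs (Finite Unit)
  | push _ _ => inferInstanceAs (Finite Unit)
  | seq p q => by
    have := finite_label p
    have := finite_label q
    exact inferInstanceAs (Finite (p.Label ⊕ q.Label))
  | case _ p => by
    have := fun o => finite_label (p o)
    exact inferInstanceAs (Finite (Option (Σ o, (p o).Label)))
  | loop _ p => by
    have := fun o => finite_label (p o)
    exact inferInstanceAs (Finite (Option (Σ b, (p b).Label)))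

/-- The label at which the machine code for a structured program starts. -/
def entry : (p : Prog) → p.Label
  | skip => ()
  | push _ _ => ()
  | seq p _ => Sum.inl p.entry
  | case _ _ => none
  | loop _ _ => none

end Prog

/-- The stack alphabets of the machine that runs a structured program on the bit stacks
`0, …, m`: besides these, there is the input stack over the alphabet `G`, with index `none`. -/
abbrev StackAlphabet (G : Type) (m : ℕ) (k : Option (Fin (m + 1))) : Type :=
  match k with
  | none => G
  | some _ => Bool

/-- The internal memory holds the last symbol popped from the input stack and the last symbol
popped from one of the bit stacks. -/
abbrev Memory (G : Type) : Type := Option G × Option Bool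

/-- The stack with number `r`. -/
def stackIndex (m r : ℕ) : Fin (m + 1) := Fin.ofNat (m + 1) r

/-- The machine code for a structured program that is embedded along `emb` into a machine with
labels `L`. The label `exit` is where the machine continues when the program has stopped. -/
def Prog.compile (G : Type) (m : ℕ) {L : Type} :
    (p : Prog) → (p.Label → L) → L → p.Label → TM2.Stmt (StackAlphabet G m) L (Memory G)
  | .skip, _, exit, _ => .goto fun _ => exit
  | .push r b, _, exit, _ => .push (some (stackIndex m r)) (fun _ => b) (.goto fun _ => exit)
  | .seq p q, emb, exit, l =>
    match l with
    | Sum.inl l => p.compile G m (fun l => emb (Sum.inl l)) (emb (Sum.inr q.entry)) l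
    | Sum.inr l => q.compile G m (fun l => emb (Sum.inr l)) exit l
  | .case r p, emb, exit, l =>
    match l with
    | none => .pop (some (stackIndex m r)) (fun v o => (v.1, o))
        (.goto fun v => emb (some ⟨v.2, (p v.2).entry⟩))
    | some ⟨o, l⟩ => (p o).compile G m (fun l => emb (some ⟨o, l⟩)) exit l
  | .loop r p, emb, exit, l =>
    match l with
    | none => .pop (some (stackIndex m r)) (fun v o => (v.1, o))
        (.goto fun v => v.2.elim exit fun b => emb (some ⟨b, (p b).entry⟩))
    | some ⟨b, l⟩ => (p b).compile G m (fun l => emb (some ⟨b, l⟩)) (emb none) l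

/-- The contents of all stacks of the machine, from those of the input stack and of the
bit stacks. -/
def allStacks {G : Type} (m : ℕ) (w : List G) (s : ℕ → List Bool) :
    (k : Option (Fin (m + 1))) → List (StackAlphabet G m k)
  | none => w
  | some i => s i

theorem allStacks_stackIndex {G : Type} {m r : ℕ} (hr : r < m + 1) (w : List G)
    (s : ℕ → List Bool) : allStacks m w s (some (stackIndex m r)) = s r := by
  change s (r % (m + 1)) = s r
  rw [Nat.mod_eq_of_lt hr]

theorem update_allStacks {G : Type} {m r : ℕ} (hr : r < m + 1) (w : List G)
    (s : ℕ → List Bool) (u : List (StackAlphabet G m (some (stackIndex m r)))) :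
    update (allStacks m w s) (some (stackIndex m r)) u = allStacks m w (update s r u) := by
  have hm : ((stackIndex m r : Fin (m + 1)) : ℕ) = r := Nat.mod_eq_of_lt hr
  funext k
  rcases k with _ | i
  · rfl
  · by_cases h : i = stackIndex m r
    · subst h
      refine (Function.update_self (some (stackIndex m r)) u (allStacks m w s)).trans ?_
      change u = update s r u ((stackIndex m r : Fin (m + 1)) : ℕ)
      rw [hm]
      exact (Function.update_self r u s).symm
    · have h' : (i : ℕ) ≠ r := fun e => h (Fin.ext (e.trans hm.symm))
      refine (Function.update_of_ne (a := some i) (a' := some (stackIndex m r))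
        (fun e => h (Option.some.inj e)) ..).trans ?_
      exact (Function.update_of_ne h' ..).symm

theorem update_allStacks_none {G : Type} {m : ℕ} (w w' : List G) (s : ℕ → List Bool) :
    update (allStacks m w s) none w' = allStacks m w' s := by
  funext k
  rcases k with _ | i
  · rfl
  · rfl

/-- The machine `M` goes from one configuration to another one in `n` steps. -/
def Steps {K : Type} [DecidableEq K] {Γ : K → Type} {L σ : Type} (M : L → TM2.Stmt Γ L σ) (n : ℕ)
    (c c' : TM2.Cfg Γ L σ) : Prop :=
  (flip bind (TM2.step M))^[n] (some c) = some c'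

section Steps

variable {K : Type} [DecidableEq K] {Γ : K → Type} {L σ : Type} {M : L → TM2.Stmt Γ L σ}

theorem Steps.trans {n n' : ℕ} {c c' c'' : TM2.Cfg Γ L σ} (h : Steps M n c c')
    (h' : Steps M n' c' c'') : Steps M (n + n') c c'' := by
  unfold Steps at *
  rw [add_comm, Function.iterate_add_apply, h, h']

theorem Steps.single {l : L} {v : σ} {S : ∀ k, List (Γ k)} {c : TM2.Cfg Γ L σ}
    (h : TM2.stepAux (M l) v S = c) : Steps M 1 ⟨some l, v, S⟩ c :=
  congrArg some h

theorem Steps.head {n : ℕ} {l : L} {v : σ} {S : ∀ k, List (Γ k)} {c c' : TM2.Cfg Γ L σ}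
    (h : TM2.stepAux (M l) v S = c) (h' : Steps M n c c') : Steps M (n + 1) ⟨some l, v, S⟩ c' := by
  rw [Nat.add_comm n 1]
  exact (Steps.single h).trans h'

end Steps

theorem stepAux_push {G L : Type} {m r : ℕ} (hr : r < m + 1) (b : Bool)
    (q : TM2.Stmt (StackAlphabet G m) L (Memory G)) (v : Memory G) (w : List G)
    (s : ℕ → List Bool) :
    TM2.stepAux (.push (some (stackIndex m r)) (fun _ => b) q) v (allStacks m w s) =
      TM2.stepAux q v (allStacks m w (update s r (b :: s r))) := by
  rw [← allStacks_stackIndex hr w s]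
  exact congrArg (TM2.stepAux q v) (update_allStacks hr w s _)

theorem stepAux_pop {G L : Type} {m r : ℕ} (hr : r < m + 1)
    (q : TM2.Stmt (StackAlphabet G m) L (Memory G)) (v : Memory G) (w : List G)
    (s : ℕ → List Bool) :
    TM2.stepAux (.pop (some (stackIndex m r)) (fun v o => (v.1, o)) q) v (allStacks m w s) =
      TM2.stepAux q (v.1, (s r).head?) (allStacks m w (update s r (s r).tail)) := by
  rw [← allStacks_stackIndex hr w s]
  exact congrArg (TM2.stepAux q _) (update_allStacks hr w s _)

/-- The machine code simulates the structured program, with one machine step for each of its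
steps. The code may be part of a larger machine `M`, in which it sits at the labels in the range of
`emb`. -/
theorem Run.steps {G : Type} {m : ℕ} {L : Type}
    (M : L → TM2.Stmt (StackAlphabet G m) L (Memory G)) (w : List G)
    {p : Prog} {s s' : ℕ → List Bool} {t : ℕ} (h : Run p s s' t) (hp : p.Bounded (m + 1))
    (emb : p.Label → L) (exit : L) (hM : ∀ l, M (emb l) = p.compile G m emb exit l)
    (v : Memory G) :
    ∃ v', Steps M t ⟨some (emb p.entry), v, allStacks m w s⟩
      ⟨some exit, v', allStacks m w s'⟩ := by
  induction h generalizing exit v with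
  | skip s => exact ⟨v, Steps.single (by rw [hM]; rfl)⟩
  | push s r b => exact ⟨v, Steps.single (by rw [hM]; exact stepAux_push hp ..)⟩
  | @seq p q s s' s'' t t' _ _ ih ih' =>
    obtain ⟨v', h₁⟩ := ih hp.1 (fun l => emb (Sum.inl l)) (emb (Sum.inr q.entry))
      (fun l => hM (Sum.inl l)) v
    obtain ⟨v'', h₂⟩ := ih' hp.2 (fun l => emb (Sum.inr l)) exit (fun l => hM (Sum.inr l)) v'
    exact ⟨v'', h₁.trans h₂⟩
  | @case r p s s' t _ ih =>
    obtain ⟨v', h₂⟩ := ih (hp.2 _) (fun l => emb (some ⟨_, l⟩)) exit (fun l => hM (some ⟨_, l⟩))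
      (v.1, (s r).head?)
    exact ⟨v', Steps.head (by rw [hM]; exact stepAux_pop hp.1 ..) h₂⟩
  | @loop_nil r p s hs =>
    refine ⟨(v.1, none), Steps.single ?_⟩
    rw [hM]
    refine (stepAux_pop hp.1 ..).trans ?_
    have : update s r [] = s := by rw [← hs, Function.update_eq_self]
    rw [hs, List.tail_nil, this]
    rfl
  | @loop_cons r p s s' s'' b u t t' hs _ _ ih ih' =>
    obtain ⟨v', h₂⟩ := ih (hp.2 _) (fun l => emb (some ⟨_, l⟩)) (emb none)
      (fun l => hM (some ⟨_, l⟩)) (v.1, some b)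
    obtain ⟨v'', h₃⟩ := ih' hp emb exit hM v'
    refine ⟨v'', Steps.head ?_ (h₂.trans h₃)⟩
    rw [hM]
    refine (stepAux_pop hp.1 ..).trans ?_
    rw [hs]
    rfl

/-! ### Loading the input -/

/-- The labels of a machine that reads its input and then runs the program `p`. -/
inductive LoadLabel (G : Type) (p : Prog) : Type
  | read
  | letter (a : G)
  | prog (l : p.Label)
  | done

theorem finite_loadLabel (G : Type) [Finite G] (p : Prog) : Finite (LoadLabel G p) := by
  have := p.finite_label
  refine Finite.of_injective
    (fun l : LoadLabel G p => match l with
      | .read => (Sum.inl none : Option (Option G) ⊕ p.Label)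
      | .letter a => Sum.inl (some (some a))
      | .prog l => Sum.inr l
      | .done => Sum.inl (some none)) ?_
  rintro (_ | _ | _ | _) (_ | _ | _ | _) h <;> simp_all

/-- Push a word, the first bit first. -/
def pushWord {G : Type} {m : ℕ} {L : Type} (r : Fin (m + 1)) :
    List Bool → TM2.Stmt (StackAlphabet G m) L (Memory G) →
      TM2.Stmt (StackAlphabet G m) L (Memory G)
  | [], q => q
  | b :: u, q => .push (some r) (fun _ => b) (pushWord r u q)

/-- The code of the machine that translates its input to bits letter by letter, with `block`,
leaving the reversed result on the stack `1`, and then runs `p`. -/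
def loadCode {G : Type} (m : ℕ) (block : G → List Bool) (p : Prog) :
    LoadLabel G p → TM2.Stmt (StackAlphabet G m) (LoadLabel G p) (Memory G)
  | .read => .pop none (fun v o => (o, v.2))
      (.goto fun v => v.1.elim (.prog p.entry) fun a => .letter a)
  | .letter a => pushWord (stackIndex m 1) (block a) (.goto fun _ => .read)
  | .prog l => p.compile G m .prog .done l
  | .done => .load (fun _ => (none, none)) .halt

/-- A machine that reads its input and then runs the program `p`. The output is left on the
stack `0`. -/
noncomputable def loadMachine {G : Type} [Fintype G] (m : ℕ) (block : G → List Bool) (p : Prog) :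
    FinTM2 :=
  { K := Option (Fin (m + 1))
    k₀ := none
    k₁ := some (stackIndex m 0)
    Γ := StackAlphabet G m
    Λ := LoadLabel G p
    main := .read
    ΛFin := by
      have := finite_loadLabel G p
      exact Fintype.ofFinite _
    σ := Memory G
    initialState := (none, none)
    σFin := inferInstance
    Γk₀Fin := inferInstanceAs (Fintype G)
    m := loadCode m block p }

theorem stepAux_pushWord {G : Type} {m : ℕ} {L : Type} {r : ℕ} (hr : r < m + 1) (u : List Bool)
    (q : TM2.Stmt (StackAlphabet G m) L (Memory G)) (v : Memory G) (w : List G)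
    (s : ℕ → List Bool) :
    TM2.stepAux (pushWord (stackIndex m r) u q) v (allStacks m w s) =
      TM2.stepAux q v (allStacks m w (update s r (u.reverse ++ s r))) := by
  induction u generalizing s with
  | nil => simp [pushWord]
  | cons b u ih =>
    refine (stepAux_push hr b _ v w s).trans ((ih _).trans ?_)
    simp

theorem load_steps {G : Type} (m : ℕ) (hm : 1 ≤ m) (block : G → List Bool) (p : Prog)
    (w : List G) (s : ℕ → List Bool) (v : Memory G) :
    ∃ v', Steps (loadCode m block p) (2 * w.length + 1) ⟨some .read, v, allStacks m w s⟩
      ⟨some (.prog p.entry), v',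
        allStacks m [] (update s 1 ((w.map block).flatten.reverse ++ s 1))⟩ := by
  induction w generalizing s v with
  | nil =>
    refine ⟨(none, v.2), Steps.single ?_⟩
    refine (congrArg (TM2.stepAux _ _) (update_allStacks_none ..)).trans ?_
    simp only [List.map_nil, List.flatten_nil, List.reverse_nil, List.nil_append,
      Function.update_eq_self]
    rfl
  | cons a w ih =>
    obtain ⟨v', h⟩ := ih (update s 1 ((block a).reverse ++ s 1)) (some a, v.2)
    simp only [Function.update_idem, Function.update_self] at h
    refine ⟨v', ?_⟩
    rw [show 2 * (a :: w).length + 1 = 2 * w.length + 1 + 1 + 1 by simp; omega]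
    refine Steps.head (c := ⟨some (.letter a), (some a, v.2), allStacks m w s⟩)
      (congrArg (TM2.Cfg.mk _ _) (update_allStacks_none (a :: w) w s)) ?_
    refine Steps.head (stepAux_pushWord (by omega) ..) ?_
    simpa using h

/-- The result of the translation: if a structured program computes `f` in polynomial time from the
translation of the input to bits, then a Turing machine computes `f` in polynomial time. -/
theorem polyTime_of_run {G : Type} [Fintype G] (block : G → List Bool) (p : Prog) (m : ℕ)
    (hp : p.Bounded m) (f : List G → Bool) (T : Polynomial ℕ)
    (h : ∀ w, ∃ t ≤ T.eval w.length,
      Run p (update (fun _ => []) 1 (w.map block).flatten.reverse) (update (fun _ => []) 0 [f w]) t)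
    {α : Type} (e : α → List G) : PolyTime e fun a => f (e a) := by
  have hp' : p.Bounded (m + 1 + 1) := hp.mono (by omega)
  have key : ∀ w : List G, Nonempty (TM2OutputsInTime (loadMachine (m + 1) block p) w
      (some [f w]) ((T + 2 * Polynomial.X + 2).eval w.length)) := by
    intro w
    obtain ⟨t, ht, hr⟩ := h w
    obtain ⟨v, h₁⟩ := load_steps (m + 1) (by omega) block p w (fun _ => []) (none, none)
    simp only [List.append_nil] at h₁
    obtain ⟨v', h₂⟩ := hr.steps (loadCode (m + 1) block p) [] hp' .prog .done (fun _ => rfl) v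
    have h₄ := (h₁.trans h₂).trans (Steps.single (c := ⟨none, (none, none), _⟩) rfl)
    refine ⟨⟨⟨2 * w.length + 1 + t + 1, ?_⟩, ?_⟩⟩
    · have e₁ : initList (loadMachine (m + 1) block p) w =
          ⟨some .read, (none, none), allStacks (m + 1) w (fun _ => [])⟩ := by
        simp only [initList]
        congr 1
        funext k
        rcases k with _ | k <;> rfl
      have e₂ : haltList (loadMachine (m + 1) block p) [f w] =
          ⟨none, (none, none), allStacks (m + 1) [] (update (fun _ => []) 0 [f w])⟩ := by
        simp only [haltList]
        congr 1
        funext k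
        rcases k with _ | k
        · rfl
        · by_cases hk : k = stackIndex (m + 1) 0
          · subst hk
            refine (dif_pos rfl).trans ?_
            exact (allStacks_stackIndex (Nat.succ_pos _) ([] : List G)
              (update (fun _ => []) 0 [f w])).symm
          · refine (dif_neg fun e => hk (Option.some.inj e)).trans ?_
            have : (k : ℕ) ≠ 0 := fun e => hk (Fin.ext (by simp [stackIndex, e]))
            exact (Function.update_of_ne (f := fun _ => []) this [f w]).symm
      rw [e₁, Option.map_some, e₂]
      exact h₄
    · simp only [Polynomial.eval_add, Polynomial.eval_mul, Polynomial.eval_ofNat, Polynomial.eval_X]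
      omega
  have key' : ∀ (w w' : List G) (o : List Bool), w' = w → o = [f w] →
      Nonempty (TM2OutputsInTime (loadMachine (m + 1) block p) w'
        (some o) ((T + 2 * Polynomial.X + 2).eval w.length)) := by
    rintro w _ _ rfl rfl
    exact key _
  refine ⟨⟨⟨loadMachine (m + 1) block p, Equiv.refl _, Equiv.refl _⟩, T + 2 * Polynomial.X + 2,
    fun a => ?_⟩⟩
  have h₁ : List.map (Equiv.refl G).invFun (e a) = e a := List.map_id _
  have h₂ : List.map (Equiv.refl Bool).invFun (Computability.encodeBool (f (e a))) = [f (e a)] :=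
    List.map_id _
  exact (key' _ _ _ h₁ h₂).some

end TreeRewriting

namespace TreeRewriting

open Function (update)

/-! ### Data and their codes -/

/-- The universal data type on which structured programs operate: binary trees. -/
inductive Data
  | nil
  | cons (a b : Data)

namespace Data

/-- The Polish notation of a binary tree. -/
def code : Data → List Bool
  | nil => [false]
  | cons a b => true :: (a.code ++ b.code)

def head : Data → Data
  | nil => nil
  | cons a _ => a

def tail : Data → Data
  | nil => nil
  | cons _ b => b

end Data

/-- A type whose elements are represented by binary trees. -/
class Enc (α : Type) where
  enc : α → Data

open Enc (enc)

instance : Enc Data := ⟨id⟩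

instance : Enc Bool := ⟨fun b => if b then .cons .nil .nil else .nil⟩

instance {α β : Type} [Enc α] [Enc β] : Enc (α × β) := ⟨fun p => .cons (enc p.1) (enc p.2)⟩

/-- A list is represented by the tree with right spine of the same length. -/
def encList {α : Type} [Enc α] : List α → Data
  | [] => .nil
  | a :: l => .cons (enc a) (encList l)

instance {α : Type} [Enc α] : Enc (List α) := ⟨encList⟩

instance {α : Type} [Enc α] (P : α → Prop) : Enc {a // P a} := ⟨fun a => enc a.1⟩

/-- The size of an object: the length of the code of its representation. -/
def size {α : Type} [Enc α] (a : α) : ℕ := (enc a).code.length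

/-! ### Running time of structured programs -/

/-- The program `p` transforms the stacks `s` into `s'` in at most `n` steps. -/
def RunLe (p : Prog) (s s' : ℕ → List Bool) (n : ℕ) : Prop := ∃ t ≤ n, Run p s s' t

theorem RunLe.mono {p : Prog} {s s' : ℕ → List Bool} {n n' : ℕ} (h : RunLe p s s' n)
    (hn : n ≤ n') : RunLe p s s' n' :=
  let ⟨t, ht, hr⟩ := h
  ⟨t, ht.trans hn, hr⟩

theorem RunLe.of_eq {p : Prog} {s s' s'' : ℕ → List Bool} {n n' : ℕ} (h : RunLe p s s' n)
    (e : s' = s'') (hn : n ≤ n') : RunLe p s s'' n' :=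
  e ▸ h.mono hn

theorem RunLe.seq {p q : Prog} {s s' s'' : ℕ → List Bool} {n n' : ℕ} (h : RunLe p s s' n)
    (h' : RunLe q s' s'' n') : RunLe (.seq p q) s s'' (n + n') :=
  let ⟨_, ht, hr⟩ := h
  let ⟨_, ht', hr'⟩ := h'
  ⟨_, add_le_add ht ht', hr.seq hr'⟩

theorem RunLe.case {r : ℕ} {p : Option Bool → Prog} {s s' : ℕ → List Bool} {n : ℕ}
    (h : RunLe (p (s r).head?) (update s r (s r).tail) s' n) :
    RunLe (.case r p) s s' (n + 1) :=
  let ⟨_, ht, hr⟩ := h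
  ⟨_, Nat.succ_le_succ ht, hr.case⟩

theorem RunLe.loop_nil {r : ℕ} {p : Bool → Prog} {s : ℕ → List Bool} (h : s r = []) :
    RunLe (.loop r p) s s 1 :=
  ⟨1, le_rfl, .loop_nil h⟩

theorem RunLe.loop_cons {r : ℕ} {p : Bool → Prog} {s s' s'' : ℕ → List Bool} {n n' : ℕ} {b : Bool}
    {u : List Bool} (hs : s r = b :: u) (h : RunLe (p b) (update s r u) s' n)
    (h' : RunLe (.loop r p) s' s'' n') : RunLe (.loop r p) s s'' (n + n' + 1) :=
  let ⟨_, ht, hr⟩ := h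
  let ⟨_, ht', hr'⟩ := h'
  ⟨_, by omega, hr.loop_cons hs hr'⟩

theorem RunLe.skip (s : ℕ → List Bool) : RunLe .skip s s 1 := ⟨1, le_rfl, .skip s⟩

theorem RunLe.push (s : ℕ → List Bool) (r : ℕ) (b : Bool) :
    RunLe (.push r b) s (update s r (b :: s r)) 1 := ⟨1, le_rfl, .push s r b⟩

/-- A stack grows by at most one symbol in each step. -/
theorem Run.length_le {p : Prog} {s s' : ℕ → List Bool} {t : ℕ} (h : Run p s s' t) (r : ℕ) :
    (s' r).length ≤ (s r).length + t := by
  induction h with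
  | skip s => omega
  | push s r' b =>
    by_cases hr : r = r'
    · subst hr; simp
    · simp [Function.update_of_ne hr]
  | seq _ _ ih ih' => omega
  | @case r' p s s' t _ ih =>
    refine ih.trans ?_
    by_cases hr : r = r'
    · subst hr; simp; omega
    · simp [Function.update_of_ne hr]
  | loop_nil _ => omega
  | @loop_cons r' p s s' s'' b u t t' hs _ _ ih ih' =>
    have : (update s r' u r).length ≤ (s r).length := by
      by_cases hr : r = r'
      · subst hr; simp [hs]
      · simp [Function.update_of_ne hr]
    omega

/-! ### Basic programs -/

/-- Move the stack `r` to the stack `r'`, reversing its order. -/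
def Prog.rev (r r' : ℕ) : Prog := .loop r fun b => .push r' b

theorem runLe_rev {r r' : ℕ} (hr : r ≠ r') (s : ℕ → List Bool) :
    RunLe (.rev r r') s (update (update s r []) r' ((s r).reverse ++ s r'))
      (2 * (s r).length + 1) := by
  generalize hu : s r = u
  induction u generalizing s with
  | nil =>
    refine (RunLe.loop_nil hu).of_eq ?_ le_rfl
    funext i
    simp only [Function.update_apply]
    split_ifs <;> simp_all
  | cons b u ih =>
    have h := ih (update (update s r u) r' (b :: s r'))
      (by rw [Function.update_of_ne hr, Function.update_self])
    have h₁ := RunLe.push (update s r u) r' b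
    rw [Function.update_of_ne hr.symm] at h₁
    refine (RunLe.loop_cons hu h₁ h).of_eq ?_ (by simp; omega)
    funext i
    simp only [Function.update_apply]
    split_ifs <;> simp_all

/-- Move the stack `r` to both of the stacks `r₁` and `r₂`, reversing its order. -/
def Prog.dup (r r₁ r₂ : ℕ) : Prog := .loop r fun b => .seq (.push r₁ b) (.push r₂ b)

theorem runLe_dup {r r₁ r₂ : ℕ} (h₁ : r ≠ r₁) (h₂ : r ≠ r₂) (h₁₂ : r₁ ≠ r₂) (s : ℕ → List Bool) :
    RunLe (.dup r r₁ r₂) s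
      (update (update (update s r []) r₁ ((s r).reverse ++ s r₁)) r₂ ((s r).reverse ++ s r₂))
      (3 * (s r).length + 1) := by
  generalize hu : s r = u
  induction u generalizing s with
  | nil =>
    refine (RunLe.loop_nil hu).of_eq ?_ le_rfl
    funext i
    simp only [Function.update_apply]
    split_ifs <;> simp_all
  | cons b u ih =>
    have h := ih (update (update (update s r u) r₁ (b :: s r₁)) r₂ (b :: s r₂))
      (by rw [Function.update_of_ne h₂, Function.update_of_ne h₁, Function.update_self])
    have h₃ := RunLe.push (update s r u) r₁ b
    rw [Function.update_of_ne h₁.symm] at h₃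
    have h₄ := RunLe.push (update (update s r u) r₁ (b :: s r₁)) r₂ b
    rw [Function.update_of_ne h₁₂.symm, Function.update_of_ne h₂.symm] at h₄
    refine (RunLe.loop_cons hu (h₃.seq h₄) h).of_eq ?_ (by simp; omega)
    funext i
    simp only [Function.update_apply]
    split_ifs <;> simp_all

/-- Empty the stack `r`. -/
def Prog.clear (r : ℕ) : Prog := .loop r fun _ => .skip

theorem runLe_clear (r : ℕ) (s : ℕ → List Bool) :
    RunLe (.clear r) s (update s r []) (2 * (s r).length + 1) := by
  generalize hu : s r = u
  induction u generalizing s with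
  | nil =>
    refine (RunLe.loop_nil hu).of_eq ?_ le_rfl
    rw [← hu, Function.update_eq_self]
  | cons b u ih =>
    have h := ih (update s r u) (by rw [Function.update_self])
    rw [Function.update_idem] at h
    exact (RunLe.loop_cons hu (RunLe.skip _) h).mono (by simp; omega)

/-- Pop a symbol from the stack `r`. -/
def Prog.pop (r : ℕ) : Prog := .case r fun _ => .skip

theorem runLe_pop (r : ℕ) (s : ℕ → List Bool) :
    RunLe (.pop r) s (update s r (s r).tail) 2 :=
  (RunLe.skip _).case

/-- One round of `Prog.take`. -/
def Prog.takeBody (r c r' : ℕ) : Prog :=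
  .case r fun o => match o with
    | some true => .seq (.push r' true) (.seq (.push c false) (.push c false))
    | _ => .push r' false

/-- Move the code of a tree that lies on top of the stack `r` to the stack `r'`, reversing its
order. The stack `c` counts the subtrees that remain to be read. -/
def Prog.take (r c r' : ℕ) : Prog :=
  .seq (.push c false) (.loop c fun _ => .takeBody r c r')

/-- The loop of `Prog.take` spends one item of the counter on moving the code of the tree `d` on top
of the stack `r`, and then goes on with the rest of the counter. -/
theorem runLe_take_aux {r c r' : ℕ} (h₁ : r ≠ c) (h₂ : r ≠ r') (h₃ : c ≠ r') (d : Data) :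
    ∀ (s s' : ℕ → List Bool) (u v : List Bool) (n : ℕ), s r = d.code ++ u → s c = false :: v →
      RunLe (.loop c fun _ => .takeBody r c r')
        (update (update (update s r u) c v) r' (d.code.reverse ++ s r')) s' n →
      RunLe (.loop c fun _ => .takeBody r c r') s s' (5 * d.code.length + n) := by
  induction d with
  | nil =>
    intro s s' u v n hr hc h
    have e : update (update s c v) r (false :: u).tail = update (update s r u) c v := by
      funext i
      simp only [Function.update_apply]
      split_ifs <;> simp_all
    have hb : RunLe (Prog.takeBody r c r') (update s c v)
        (update (update (update s r u) c v) r' (Data.nil.code.reverse ++ s r')) 2 := by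
      refine RunLe.case ?_
      rw [Function.update_of_ne h₁, hr]
      simp only [Data.code, List.cons_append, List.nil_append, List.head?_cons]
      rw [e]
      have := RunLe.push (update (update s r u) c v) r' false
      rw [Function.update_of_ne h₃.symm, Function.update_of_ne h₂.symm] at this
      exact this
    exact (RunLe.loop_cons hc hb h).mono (by simp [Data.code])
  | cons a b iha ihb =>
    intro s s' u v n hr hc h
    have hb : RunLe (Prog.takeBody r c r') (update s c v)
        (update (update (update s r (a.code ++ (b.code ++ u))) c (false :: false :: v)) r'
          (true :: s r')) 4 := by
      refine RunLe.case ?_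
      rw [Function.update_of_ne h₁, hr]
      simp only [Data.code, List.cons_append, List.head?_cons, List.tail_cons]
      have h₄ := RunLe.push (update (update s c v) r (a.code ++ b.code ++ u)) r' true
      have h₅ := RunLe.push (update (update (update s c v) r (a.code ++ b.code ++ u)) r'
        (true :: s r')) c false
      have h₆ := RunLe.push (update (update (update (update s c v) r (a.code ++ b.code ++ u)) r'
        (true :: s r')) c (false :: v)) c false
      rw [Function.update_of_ne h₂.symm, Function.update_of_ne h₃.symm] at h₄
      rw [Function.update_of_ne h₃, Function.update_of_ne h₁.symm, Function.update_self] at h₅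
      rw [Function.update_self] at h₆
      convert h₄.seq (h₅.seq h₆) using 1
      funext i
      simp only [Function.update_apply]
      split_ifs <;> simp_all
    have key := iha (update (update (update s r (a.code ++ (b.code ++ u))) c
          (false :: false :: v)) r' (true :: s r'))
        s' (b.code ++ u) (false :: v) (5 * b.code.length + n)
        (by simp [h₁, h₂])
        (by simp [h₃]) ?_
    · exact (RunLe.loop_cons hc hb key).mono (by simp [Data.code]; omega)
    · refine ihb _ _ u v n (by simp [h₁, h₂])
        (by simp [h₃]) ?_
      convert h using 1
      funext i
      simp only [Function.update_apply]
      split_ifs <;> simp_all [Data.code]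

theorem runLe_take {r c r' : ℕ} (h₁ : r ≠ c) (h₂ : r ≠ r') (h₃ : c ≠ r') (s : ℕ → List Bool)
    (d : Data) (u : List Bool) (hr : s r = d.code ++ u) (hc : s c = []) :
    RunLe (.take r c r') s (update (update s r u) r' (d.code.reverse ++ s r'))
      (5 * d.code.length + 2) := by
  refine ((RunLe.push s c false).seq (runLe_take_aux h₁ h₂ h₃ d _ _ u [] 1
    (by rw [Function.update_of_ne h₁, hr]) (by rw [Function.update_self, hc])
    (RunLe.loop_nil (by simp [h₃])))).of_eq ?_ (by omega)
  funext i
  simp only [Function.update_apply]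
  split_ifs <;> simp_all

end TreeRewriting

namespace TreeRewriting

open Function (update)
open Enc (enc)

/-! ### Functions computed by structured programs in polynomial time -/

/-- The function `f` is computed by a structured program in polynomial time. The program finds the
code of the argument on the stack `0` and replaces it by the code of the value; the stacks
`1, …, M` are empty at the beginning and at the end, and the other stacks are not touched. -/
@[fun_prop]
def FP {α β : Type} [Enc α] [Enc β] (f : α → β) : Prop :=
  ∃ (p : Prog) (M : ℕ) (T : Polynomial ℕ), p.Bounded (M + 1) ∧
    ∀ (a : α) (s : ℕ → List Bool), s 0 = (enc a).code → (∀ i, 1 ≤ i → i ≤ M → s i = []) →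
      RunLe p s (update s 0 (enc (f a)).code) (T.eval (size a))

theorem eval_le_eval (T : Polynomial ℕ) {a b : ℕ} (h : a ≤ b) : T.eval a ≤ T.eval b := by
  rw [Polynomial.eval_eq_sum, Polynomial.eval_eq_sum]
  exact Finset.sum_le_sum fun i _ => Nat.mul_le_mul_left _ (Nat.pow_le_pow_left h i)

/-- The stacks `s`, with new contents `x` of the stack `0` and `a`, …, `e` of the stacks
`M + 1, …, M + 5`. -/
def regs (M : ℕ) (s : ℕ → List Bool) (x a b c d e : List Bool) : ℕ → List Bool := fun i =>
  if i = 0 then x else if i = M + 1 then a else if i = M + 2 then b else if i = M + 3 then c else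
    if i = M + 4 then d else if i = M + 5 then e else s i

section regs

variable (M : ℕ) (s : ℕ → List Bool) (x a b c d e y : List Bool)

@[simp] theorem regs_apply_zero : regs M s x a b c d e 0 = x := by simp [regs]
@[simp] theorem regs_apply_one : regs M s x a b c d e (M + 1) = a := by simp [regs]
@[simp] theorem regs_apply_two : regs M s x a b c d e (M + 2) = b := by simp [regs]
@[simp] theorem regs_apply_three : regs M s x a b c d e (M + 3) = c := by simp [regs]
@[simp] theorem regs_apply_four : regs M s x a b c d e (M + 4) = d := by simp [regs]
@[simp] theorem regs_apply_five : regs M s x a b c d e (M + 5) = e := by simp [regs]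

@[simp] theorem update_regs_zero :
    update (regs M s x a b c d e) 0 y = regs M s y a b c d e := by
  funext i; simp only [regs, Function.update_apply]; split_ifs <;> rfl
@[simp] theorem update_regs_one :
    update (regs M s x a b c d e) (M + 1) y = regs M s x y b c d e := by
  funext i; simp only [regs, Function.update_apply]; split_ifs <;> first | rfl | omega
@[simp] theorem update_regs_two :
    update (regs M s x a b c d e) (M + 2) y = regs M s x a y c d e := by
  funext i; simp only [regs, Function.update_apply]; split_ifs <;> first | rfl | omega
@[simp] theorem update_regs_three :
    update (regs M s x a b c d e) (M + 3) y = regs M s x a b y d e := by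
  funext i; simp only [regs, Function.update_apply]; split_ifs <;> first | rfl | omega
@[simp] theorem update_regs_four :
    update (regs M s x a b c d e) (M + 4) y = regs M s x a b c y e := by
  funext i; simp only [regs, Function.update_apply]; split_ifs <;> first | rfl | omega

variable {M s}

theorem eq_regs (h : ∀ i, 1 ≤ i → i ≤ M + 5 → s i = []) :
    s = regs M s (s 0) [] [] [] [] [] := by
  funext i
  simp only [regs]
  split_ifs with h₀ <;> first | rfl | (exact h i (by omega) (by omega)) | rw [h₀]

theorem regs_of_le (h : ∀ i, 1 ≤ i → i ≤ M + 5 → s i = []) {i : ℕ} (h₁ : 1 ≤ i) (h₂ : i ≤ M) :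
    regs M s x a b c d e i = [] := by
  simp only [regs]; split_ifs <;> first | omega | exact h i h₁ (by omega)

end regs

/-- To show that `f` is in `FP`, it suffices to give a program that has five work stacks. -/
theorem FP.of_regs {α β : Type} [Enc α] [Enc β] {f : α → β} (p : Prog) (M : ℕ) (T : Polynomial ℕ)
    (hp : p.Bounded (M + 6))
    (h : ∀ (a : α) (s : ℕ → List Bool),
      (∀ x a b c d e i, 1 ≤ i → i ≤ M → regs M s x a b c d e i = []) →
      RunLe p (regs M s (enc a).code [] [] [] [] []) (regs M s (enc (f a)).code [] [] [] [] [])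
        (T.eval (size a))) : FP f := by
  refine ⟨p, M + 5, T, hp, fun a s h₀ hs => ?_⟩
  have := h a s fun x a b c d e i => regs_of_le x a b c d e hs
  rw [← h₀, ← eq_regs hs] at this
  convert this using 1
  conv_lhs => rw [eq_regs hs]
  simp

/-- The value of a function in `FP` has polynomial size, as the program needs at least one step for
each symbol that it writes. -/
theorem FP.size_le {α β : Type} [Enc α] [Enc β] {f : α → β} (hf : FP f) :
    ∃ S : Polynomial ℕ, ∀ a, size (f a) ≤ S.eval (size a) := by
  obtain ⟨p, M, T, -, h⟩ := hf
  refine ⟨T + Polynomial.X, fun a => ?_⟩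
  obtain ⟨t, ht, hr⟩ := h a (update (fun _ => []) 0 (enc a).code) (by simp)
    fun i hi _ => Function.update_of_ne (by omega) ..
  have := hr.length_le 0
  simp only [Function.update_self, Polynomial.eval_add, Polynomial.eval_X] at this ⊢
  simp only [size] at *
  omega

theorem FP.of_enc_eq {α β : Type} [Enc α] [Enc β] {f : α → β} {g : Data → Data} (hg : FP g)
    (h : ∀ a, g (enc a) = enc (f a)) : FP f := by
  obtain ⟨p, M, T, hp, hr⟩ := hg
  exact ⟨p, M, T, hp, fun a s h₀ hs => h a ▸ hr (enc a) s h₀ hs⟩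

theorem FP.of_eq {α β : Type} [Enc α] [Enc β] {f g : α → β} (hf : FP f) (h : ∀ a, f a = g a) :
    FP g := funext h ▸ hf

section Basic

variable {α β γ : Type} [Enc α] [Enc β] [Enc γ]

@[fun_prop]
theorem FP.id : FP fun a : α => a := by
  refine ⟨.skip, 0, 1, trivial, fun a s h₀ _ => ?_⟩
  rw [← h₀, Function.update_eq_self, Polynomial.eval_one]
  exact RunLe.skip s

/-- Push a word on the stack `0`, the last bit first. -/
def Prog.word : List Bool → Prog
  | [] => .skip
  | b :: u => .seq (Prog.word u) (.push 0 b)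

theorem Prog.bounded_word (M : ℕ) : ∀ u, (Prog.word u).Bounded (M + 1)
  | [] => trivial
  | _ :: u => ⟨Prog.bounded_word M u, Nat.succ_pos _⟩

theorem runLe_word (u : List Bool) (s : ℕ → List Bool) :
    RunLe (.word u) s (update s 0 (u ++ s 0)) (u.length + 1) := by
  induction u with
  | nil => exact (RunLe.skip s).of_eq (by simp) le_rfl
  | cons b u ih => exact (ih.seq (RunLe.push _ 0 b)).of_eq (by simp) le_rfl

@[fun_prop]
theorem FP.const (c : β) : FP fun _ : α => c := by
  refine ⟨.seq (.clear 0) (.word (enc c).code), 0,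
    2 * Polynomial.X + 2 + Polynomial.C (enc c).code.length,
    ⟨⟨Nat.one_pos, fun _ => trivial⟩, Prog.bounded_word 0 _⟩, fun a s h₀ _ => ?_⟩
  refine ((runLe_clear 0 s).seq (runLe_word _ _)).of_eq (by simp) ?_
  simp [h₀, size]
  omega

@[fun_prop]
theorem FP.comp {f : β → γ} {g : α → β} (hf : FP f) (hg : FP g) : FP fun a => f (g a) := by
  obtain ⟨S, hS⟩ := hg.size_le
  obtain ⟨p, M, T, hp, h⟩ := hf
  obtain ⟨p', M', T', hp', h'⟩ := hg
  refine ⟨.seq p' p, max M M', T' + T.comp S,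
    ⟨hp'.mono (by omega), hp.mono (by omega)⟩, fun a s h₀ hs => ?_⟩
  have h₁ := h' a s h₀ fun i hi hi' => hs i hi (by omega)
  have h₂ := h (g a) (update s 0 (enc (g a)).code) (by simp) fun i hi hi' => by
    rw [Function.update_of_ne (by omega)]
    exact hs i hi (by omega)
  refine (h₁.seq h₂).of_eq (by simp) ?_
  simp only [Polynomial.eval_add, Polynomial.eval_comp]
  have := eval_le_eval T (hS a)
  omega

theorem FP.head : FP Data.head := by
  refine FP.of_regs (.case 0 fun o => match o with
    | some true => .seq (.take 0 2 1) (.seq (.clear 0) (.rev 1 0))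
    | _ => .push 0 false) 0 (20 * Polynomial.X + 20) ?_ ?_
  · refine ⟨by omega, fun o => ?_⟩
    rcases o with _ | _ | _ <;> simp [Prog.Bounded, Prog.take, Prog.takeBody, Prog.clear, Prog.rev]
    rintro (_ | _ | _) <;> simp [Prog.Bounded]
  · intro d s hs
    cases d with
    | nil =>
      refine (RunLe.case (n := 1) ?_).mono (by simp)
      simpa [enc, Data.code, Data.head] using
        RunLe.push (regs 0 s [] [] [] [] [] []) 0 false
    | cons a b =>
      have h₁ := runLe_take (r := 0) (c := 0 + 2) (r' := 0 + 1) (by omega) (by omega) (by omega)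
        (regs 0 s (a.code ++ b.code) [] [] [] [] []) a b.code (by simp) (by simp)
      have h₂ := runLe_clear 0 (regs 0 s b.code a.code.reverse [] [] [] [])
      have h₃ := runLe_rev (r := 0 + 1) (r' := 0) (by omega)
        (regs 0 s [] a.code.reverse [] [] [] [])
      simp only [regs_apply_zero, regs_apply_one, update_regs_zero, update_regs_one,
        List.append_nil, List.reverse_reverse, List.length_reverse] at h₁ h₂ h₃
      refine (RunLe.case (n := 5 * a.code.length + 2 + (2 * b.code.length + 1 +
        (2 * a.code.length + 1))) ?_).mono ?_
      · simpa [enc, Data.code, Data.head] using h₁.seq (h₂.seq h₃)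
      · simp [size, enc, Data.code]
        omega

theorem FP.tail : FP Data.tail := by
  refine FP.of_regs (.case 0 fun o => match o with
    | some true => .seq (.take 0 2 1) (.clear 1)
    | _ => .push 0 false) 0 (20 * Polynomial.X + 20) ?_ ?_
  · refine ⟨by omega, fun o => ?_⟩
    rcases o with _ | _ | _ <;> simp [Prog.Bounded, Prog.take, Prog.takeBody, Prog.clear]
    rintro (_ | _ | _) <;> simp [Prog.Bounded]
  · intro d s hs
    cases d with
    | nil =>
      refine (RunLe.case (n := 1) ?_).mono (by simp)
      simpa [enc, Data.code, Data.tail] using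
        RunLe.push (regs 0 s [] [] [] [] [] []) 0 false
    | cons a b =>
      have h₁ := runLe_take (r := 0) (c := 0 + 2) (r' := 0 + 1) (by omega) (by omega) (by omega)
        (regs 0 s (a.code ++ b.code) [] [] [] [] []) a b.code (by simp) (by simp)
      have h₂ := runLe_clear (0 + 1) (regs 0 s b.code a.code.reverse [] [] [] [])
      simp only [regs_apply_one, update_regs_zero, update_regs_one,
        List.append_nil, List.length_reverse] at h₁ h₂
      refine (RunLe.case (n := 5 * a.code.length + 2 + (2 * a.code.length + 1)) ?_).mono ?_
      · simpa [enc, Data.code, Data.tail] using h₁.seq h₂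
      · simp [size, enc, Data.code]
        omega

@[fun_prop]
theorem FP.fst {f : α → β × γ} (hf : FP f) : FP fun a => (f a).1 :=
  FP.comp (f := Prod.fst) (FP.head.of_enc_eq fun _ => rfl) hf

@[fun_prop]
theorem FP.snd {f : α → β × γ} (hf : FP f) : FP fun a => (f a).2 :=
  FP.comp (f := Prod.snd) (FP.tail.of_enc_eq fun _ => rfl) hf

@[fun_prop]
theorem FP.prodMk {f : α → β} {g : α → γ} (hf : FP f) (hg : FP g) : FP fun a => (f a, g a) := by
  obtain ⟨S, hS⟩ := hf.size_le
  obtain ⟨p, M₁, T, hp, h⟩ := hf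
  obtain ⟨p', M₂, T', hp', h'⟩ := hg
  obtain ⟨M, hM, hM'⟩ : ∃ M, M₁ ≤ M ∧ M₂ ≤ M := ⟨max M₁ M₂, by omega, by omega⟩
  refine FP.of_regs
    (.seq (.rev 0 (M + 2)) <| .seq (.dup (M + 2) 0 (M + 1)) <| .seq p <| .seq (.rev 0 (M + 2)) <|
      .seq (.rev (M + 1) (M + 3)) <| .seq (.rev (M + 3) 0) <| .seq p' <| .seq (.rev (M + 2) 0)
      (.push 0 true)) M (20 * Polynomial.X + 20 + T + T' + 4 * S) ?_ ?_
  · simp [Prog.Bounded, Prog.rev, Prog.dup, hp.mono (show M₁ + 1 ≤ M + 6 by omega),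
      hp'.mono (show M₂ + 1 ≤ M + 6 by omega)]
  · intro a s hs
    have h₁ := runLe_rev (r := 0) (r' := M + 2) (by omega) (regs M s (enc a).code [] [] [] [] [])
    have h₂ := runLe_dup (r := M + 2) (r₁ := 0) (r₂ := M + 1) (by omega) (by omega) (by omega)
      (regs M s [] [] (enc a).code.reverse [] [] [])
    have h₃ := h a (regs M s (enc a).code (enc a).code [] [] [] []) (by simp)
      fun i hi hi' => hs _ _ _ _ _ _ i hi (by omega)
    have h₄ := runLe_rev (r := 0) (r' := M + 2) (by omega)
      (regs M s (enc (f a)).code (enc a).code [] [] [] [])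
    have h₅ := runLe_rev (r := M + 1) (r' := M + 3) (by omega)
      (regs M s [] (enc a).code (enc (f a)).code.reverse [] [] [])
    have h₆ := runLe_rev (r := M + 3) (r' := 0) (by omega)
      (regs M s [] [] (enc (f a)).code.reverse (enc a).code.reverse [] [])
    have h₇ := h' a (regs M s (enc a).code [] (enc (f a)).code.reverse [] [] []) (by simp)
      fun i hi hi' => hs _ _ _ _ _ _ i hi (by omega)
    have h₈ := runLe_rev (r := M + 2) (r' := 0) (by omega)
      (regs M s (enc (g a)).code [] (enc (f a)).code.reverse [] [] [])
    have h₉ := RunLe.push (regs M s ((enc (f a)).code ++ (enc (g a)).code) [] [] [] [] []) 0 true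
    simp only [regs_apply_zero, regs_apply_one, regs_apply_two, regs_apply_three,
      update_regs_zero, update_regs_one, update_regs_two, update_regs_three,
      List.append_nil, List.reverse_reverse, List.length_reverse] at h₁ h₂ h₃ h₄ h₅ h₆ h₇ h₈ h₉
    refine (h₁.seq <| h₂.seq <| h₃.seq <| h₄.seq <| h₅.seq <| h₆.seq <| h₇.seq <| h₈.seq h₉).of_eq
      rfl ?_
    have := hS a
    simp only [size, Polynomial.eval_add, Polynomial.eval_mul, Polynomial.eval_X,
      Polynomial.eval_ofNat] at this ⊢
    omega

end Basic

end TreeRewriting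

namespace TreeRewriting

open Function (update)
open Enc (enc)

/-! ### Recursion on lists -/

section Fold

variable {Z A B : Type} [Enc Z] [Enc A] [Enc B]

theorem size_prod (p : A × B) : size p = size p.1 + size p.2 + 1 := by
  simp [size, enc, Data.code]

@[simp] theorem size_nil : size ([] : List A) = 1 := rfl

@[simp] theorem size_cons (a : A) (l : List A) : size (a :: l) = size a + size l + 1 := by
  simp [size, enc, encList, Data.code]

theorem code_cons (a : A) (l : List A) :
    (enc (a :: l)).code = true :: ((enc a).code ++ (enc l).code) := rfl

theorem code_prod (p : A × B) :
    (enc p).code = true :: ((enc p.1).code ++ (enc p.2).code) := rfl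

theorem length_le_size (l : List A) : l.length ≤ size l := by
  induction l with
  | nil => simp
  | cons a l ih => simp; omega

/-- One round of the program for `List.foldl`, after a symbol of the code of the list has been read.
The stacks `M + 1`, `M + 2`, `M + 3` hold the context, the accumulator and the rest of the list. -/
def Prog.foldBody (M : ℕ) (p : Prog) : Bool → Prog
  | true => .seq (.take (M + 3) (M + 5) (M + 4)) <| .seq (.rev (M + 4) 0) <|
      .seq (.rev (M + 2) (M + 4)) <| .seq (.rev (M + 4) 0) <| .seq (.push 0 true) <|
      .seq (.rev (M + 1) (M + 4)) <| .seq (.dup (M + 4) (M + 1) 0) <| .seq (.push 0 true) <|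
      .seq p <| .seq (.rev 0 (M + 4)) (.rev (M + 4) (M + 2))
  | false => .skip

/-- The loop of the program for `List.foldl`. -/
def Prog.foldLoop (M : ℕ) (p : Prog) : Prog := .loop (M + 3) (.foldBody M p)

/-- The loop computes the left fold. All intermediate results must have size at most `N`: the
running time of `p` is polynomial in the size of its argument, which contains the accumulator. -/
theorem runLe_foldLoop {h : Z × A × B → A} {p : Prog} {M : ℕ} {T : Polynomial ℕ}
    (hp : ∀ (q : Z × A × B) (s : ℕ → List Bool), s 0 = (enc q).code →
      (∀ i, 1 ≤ i → i ≤ M → s i = []) →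
      RunLe p s (update s 0 (enc (h q)).code) (T.eval (size q)))
    (s : ℕ → List Bool) (hs : ∀ x a b c d e i, 1 ≤ i → i ≤ M → regs M s x a b c d e i = [])
    (N : ℕ) (z : Z) (hz : size z ≤ N) (l : List B) (hl : size l ≤ N) (a : A)
    (ha : ∀ l', l' <+: l → size (l'.foldl (fun a b => h (z, a, b)) a) ≤ N) :
    RunLe (.foldLoop M p) (regs M s [] (enc z).code (enc a).code (enc l).code [] [])
      (regs M s [] (enc z).code (enc (l.foldl (fun a b => h (z, a, b)) a)).code [] [] [])
      ((l.length + 1) * (20 * N + 20 + T.eval (3 * N + 2))) := by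
  induction l generalizing a with
  | nil =>
    have h₁ := RunLe.skip (regs M s [] (enc z).code (enc a).code [] [] [])
    have h₂ := RunLe.loop_cons (r := M + 3) (p := Prog.foldBody M p)
      (s := regs M s [] (enc z).code (enc a).code (enc ([] : List B)).code [] []) (b := false)
      (u := []) (s'' := regs M s [] (enc z).code (enc a).code [] [] []) (by simp; rfl)
      (by rw [update_regs_three]; exact h₁) (RunLe.loop_nil (by simp))
    refine h₂.of_eq rfl ?_
    simp
    omega
  | cons b l ih =>
    have ha₀ : size a ≤ N := ha [] (List.nil_prefix)
    have ha₁ : size (h (z, a, b)) ≤ N := ha [b] (by simp)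
    simp only [size_cons] at hl
    have ih := ih (by omega) (h (z, a, b)) fun l' hl' => ha (b :: l') (by simpa using hl')
    have h₁ := runLe_take (r := M + 3) (c := M + 5) (r' := M + 4) (by omega) (by omega) (by omega)
      (regs M s [] (enc z).code (enc a).code ((enc b).code ++ (enc l).code) [] []) (enc b)
      (enc l).code (by simp) (by simp)
    have h₂ := runLe_rev (r := M + 4) (r' := 0) (by omega)
      (regs M s [] (enc z).code (enc a).code (enc l).code (enc b).code.reverse [])
    have h₃ := runLe_rev (r := M + 2) (r' := M + 4) (by omega)
      (regs M s (enc b).code (enc z).code (enc a).code (enc l).code [] [])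
    have h₄ := runLe_rev (r := M + 4) (r' := 0) (by omega)
      (regs M s (enc b).code (enc z).code [] (enc l).code (enc a).code.reverse [])
    have h₅ := RunLe.push (regs M s ((enc a).code ++ (enc b).code) (enc z).code [] (enc l).code
      [] []) 0 true
    have h₆ := runLe_rev (r := M + 1) (r' := M + 4) (by omega)
      (regs M s (enc (a, b)).code (enc z).code [] (enc l).code [] [])
    have h₇ := runLe_dup (r := M + 4) (r₁ := M + 1) (r₂ := 0) (by omega) (by omega) (by omega)
      (regs M s (enc (a, b)).code [] [] (enc l).code (enc z).code.reverse [])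
    have h₈ := RunLe.push (regs M s ((enc z).code ++ (enc (a, b)).code) (enc z).code []
      (enc l).code [] []) 0 true
    have h₉ := hp (z, a, b) (regs M s (enc (z, a, b)).code (enc z).code [] (enc l).code [] [])
      (by simp) (hs _ _ _ _ _ _)
    have h₁₀ := runLe_rev (r := 0) (r' := M + 4) (by omega)
      (regs M s (enc (h (z, a, b))).code (enc z).code [] (enc l).code [] [])
    have h₁₁ := runLe_rev (r := M + 4) (r' := M + 2) (by omega)
      (regs M s [] (enc z).code [] (enc l).code (enc (h (z, a, b))).code.reverse [])
    simp only [regs_apply_zero, regs_apply_one, regs_apply_two, regs_apply_four,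
      update_regs_zero, update_regs_one, update_regs_two, update_regs_three, update_regs_four,
      List.append_nil, List.reverse_reverse, List.length_reverse]
      at h₁ h₂ h₃ h₄ h₅ h₆ h₇ h₈ h₉ h₁₀ h₁₁
    have hb := h₁.seq <| h₂.seq <| h₃.seq <| h₄.seq <| h₅.seq <| h₆.seq <| h₇.seq <| h₈.seq <|
      h₉.seq <| h₁₀.seq h₁₁
    have key := RunLe.loop_cons (r := M + 3) (p := Prog.foldBody M p)
      (s := regs M s [] (enc z).code (enc a).code (enc (b :: l)).code [] []) (b := true)
      (u := (enc b).code ++ (enc l).code) (by simp; rfl) (by rw [update_regs_three]; exact hb) ih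
    refine key.of_eq rfl ?_
    have e := eval_le_eval T (show size (z, a, b) ≤ 3 * N + 2 by simp only [size_prod]; omega)
    have hb' : size b ≤ N := by omega
    simp only [size] at hz ha₀ ha₁ hb' e ⊢
    rw [List.length_cons, Nat.succ_mul (l.length + 1)]
    omega

/-- Left folds are in `FP` on the domain where the intermediate results have polynomial size. The
bound is part of the type of the argument, as membership in `FP` concerns all its elements. -/
theorem FP.foldl_aux {h : Z × A × B → A} (hh : FP h) (S : Polynomial ℕ) :
    FP fun q : {q : Z × A × List B // ∀ l', l' <+: q.2.2 →
      size (l'.foldl (fun a b => h (q.1, a, b)) q.2.1) ≤ S.eval (size q)} =>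
      q.1.2.2.foldl (fun a b => h (q.1.1, a, b)) q.1.2.1 := by
  obtain ⟨p, M, T, hp, hr⟩ := hh
  refine FP.of_regs
    (.seq (.pop 0) <| .seq (.take 0 (M + 5) (M + 4)) <| .seq (.rev (M + 4) (M + 1)) <|
      .seq (.pop 0) <| .seq (.take 0 (M + 5) (M + 4)) <| .seq (.rev (M + 4) (M + 2)) <|
      .seq (.rev 0 (M + 4)) <| .seq (.rev (M + 4) (M + 3)) <| .seq (.foldLoop M p) <|
      .seq (.clear (M + 1)) <| .seq (.rev (M + 2) (M + 4)) (.rev (M + 4) 0)) M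
    (40 * Polynomial.X + 40 + 10 * S + (Polynomial.X + 1) *
      (20 * (Polynomial.X + S) + 20 + T.comp (3 * (Polynomial.X + S) + 2))) ?_ ?_
  · simp [Prog.Bounded, Prog.rev, Prog.take, Prog.takeBody, Prog.foldLoop, Prog.clear,
      Prog.pop]
    constructor
    · rintro (_ | _ | _) <;> simp [Prog.Bounded]
    · constructor <;>
        simp [Prog.Bounded, Prog.foldBody, Prog.rev, Prog.dup, Prog.take, Prog.takeBody,
          hp.mono (show M + 1 ≤ M + 6 by omega)]
      rintro (_ | _ | _) <;> simp [Prog.Bounded]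
  · rintro ⟨⟨z, a, l⟩, hq⟩ s hs
    change RunLe _ (regs M s (enc (z, a, l)).code [] [] [] [] []) _
      (Polynomial.eval (size (z, a, l)) _)
    dsimp only at hq ⊢
    have hf := hq l (List.prefix_refl l)
    generalize hn' : size (z, a, l) = n at hf ⊢
    rw [hn'] at hq
    simp only [size_prod] at hn'
    have h₁ := runLe_pop 0 (regs M s (enc (z, a, l)).code [] [] [] [] [])
    have h₂ := runLe_take (r := 0) (c := M + 5) (r' := M + 4) (by omega) (by omega) (by omega)
      (regs M s ((enc z).code ++ (enc (a, l)).code) [] [] [] [] []) (enc z)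
      (enc (a, l)).code (by simp) (by simp)
    have h₃ := runLe_rev (r := M + 4) (r' := M + 1) (by omega)
      (regs M s (enc (a, l)).code [] [] [] (enc z).code.reverse [])
    have h₄ := runLe_pop 0 (regs M s (enc (a, l)).code (enc z).code [] [] [] [])
    have h₅ := runLe_take (r := 0) (c := M + 5) (r' := M + 4) (by omega) (by omega) (by omega)
      (regs M s ((enc a).code ++ (enc l).code) (enc z).code [] [] [] []) (enc a)
      (enc l).code (by simp) (by simp)
    have h₆ := runLe_rev (r := M + 4) (r' := M + 2) (by omega)
      (regs M s (enc l).code (enc z).code [] [] (enc a).code.reverse [])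
    have h₇ := runLe_rev (r := 0) (r' := M + 4) (by omega)
      (regs M s (enc l).code (enc z).code (enc a).code [] [] [])
    have h₈ := runLe_rev (r := M + 4) (r' := M + 3) (by omega)
      (regs M s [] (enc z).code (enc a).code [] (enc l).code.reverse [])
    have h₉ := runLe_foldLoop hr s hs (n + S.eval n) z (by omega) l (by omega) a
      fun l' hl' => (hq l' hl').trans (by omega)
    generalize l.foldl (fun a b => h (z, a, b)) a = r at hf h₉ ⊢
    have h₁₀ := runLe_clear (M + 1) (regs M s [] (enc z).code (enc r).code [] [] [])
    have h₁₁ := runLe_rev (r := M + 2) (r' := M + 4) (by omega)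
      (regs M s [] [] (enc r).code [] [] [])
    have h₁₂ := runLe_rev (r := M + 4) (r' := 0) (by omega)
      (regs M s [] [] [] [] (enc r).code.reverse [])
    simp only [regs_apply_zero, regs_apply_one, regs_apply_two, regs_apply_three, regs_apply_four,
      update_regs_zero, update_regs_one, update_regs_two, update_regs_three, update_regs_four,
      List.append_nil, List.reverse_reverse, List.length_reverse, code_prod, List.tail_cons]
      at h₁ h₂ h₃ h₄ h₅ h₆ h₇ h₈ h₉ h₁₀ h₁₁ h₁₂
    refine (h₁.seq <| h₂.seq <| h₃.seq <| h₄.seq <| h₅.seq <| h₆.seq <| h₇.seq <| h₈.seq <|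
      h₉.seq <| h₁₀.seq <| h₁₁.seq h₁₂).of_eq rfl ?_
    have hm : (l.length + 1) * (20 * (n + S.eval n) + 20 + T.eval (3 * (n + S.eval n) + 2)) ≤
        (n + 1) * (20 * (n + S.eval n) + 20 + T.eval (3 * (n + S.eval n) + 2)) :=
      Nat.mul_le_mul_right _ (by have := length_le_size l; omega)
    simp only [size, Polynomial.eval_add, Polynomial.eval_mul, Polynomial.eval_X,
      Polynomial.eval_ofNat, Polynomial.eval_one, Polynomial.eval_comp] at *
    omega

/-- Iteration over a list, provided that the intermediate results have polynomial size. -/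
theorem FP.foldl {h : Z → A → B → A} {init : Z → A} {l : Z → List B}
    (hh : FP fun q : Z × A × B => h q.1 q.2.1 q.2.2) (hi : FP init) (hl : FP l)
    (hS : ∃ S : Polynomial ℕ, ∀ z l', l' <+: l z →
      size (l'.foldl (h z) (init z)) ≤ S.eval (size z)) :
    FP fun z => (l z).foldl (h z) (init z) := by
  obtain ⟨S, hS⟩ := hS
  have ht : FP fun z => (z, init z, l z) := by fun_prop
  have hg : FP fun z => (⟨(z, init z, l z), fun l' hl' => (hS z l' hl').trans
      (eval_le_eval S (by simp only [size_prod]; omega))⟩ :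
      {q : Z × A × List B // ∀ l', l' <+: q.2.2 →
        size (l'.foldl (fun a b => h q.1 a b) q.2.1) ≤ S.eval (size q)}) := ht
  exact FP.comp (FP.foldl_aux hh S) hg

end Fold

end TreeRewriting

namespace TreeRewriting

open Function (update)
open Enc (enc)

/-! ### Operations on Booleans and lists in polynomial time -/

section Combinators

variable {Z A B C : Type} [Enc Z] [Enc A] [Enc B] [Enc C]

/-- A change of representation that does not change the code is free. -/
theorem FP.of_enc_id {f : A → B} (h : ∀ a, enc a = enc (f a)) : FP f :=
  FP.of_enc_eq (FP.id (α := Data)) h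

theorem size_false : size false = 1 := rfl
theorem size_true : size true = 3 := rfl

theorem size_bool_le (b : Bool) : size b ≤ 3 := by cases b <;> simp [size_true, size_false]

theorem one_le_size (a : A) : 1 ≤ size a := by
  unfold size
  cases enc a <;> simp [Data.code]

@[fun_prop]
theorem FP.cond {c : Z → Bool} {f g : Z → A} (hc : FP c) (hf : FP f) (hg : FP g) :
    FP fun z => bif c z then f z else g z := by
  obtain ⟨S, hS⟩ := hf.size_le
  obtain ⟨S', hS'⟩ := hg.size_le
  have h₀ : FP fun b : Bool => bif b then [false] else [] :=
    FP.of_enc_id (by rintro (_ | _) <;> rfl)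
  have h₁ := FP.foldl (h := fun z _ _ => f z) (init := g)
    (l := fun z => bif c z then [false] else []) (by fun_prop) hg (h₀.comp hc)
    ⟨S + S', fun z l' _ => by
      rcases List.eq_nil_or_concat l' with rfl | ⟨l, b, rfl⟩
      · simpa using (hS' z).trans (Nat.le_add_left _ _)
      · simpa using (hS z).trans (Nat.le_add_right _ _)⟩
  exact h₁.of_eq fun z => by cases c z <;> rfl

@[fun_prop]
theorem FP.and {c d : Z → Bool} (hc : FP c) (hd : FP d) : FP fun z => c z && d z :=
  (FP.cond hc hd (FP.const false)).of_eq fun z => by cases c z <;> rfl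

@[fun_prop]
theorem FP.or {c d : Z → Bool} (hc : FP c) (hd : FP d) : FP fun z => c z || d z :=
  (FP.cond hc (FP.const true) hd).of_eq fun z => by cases c z <;> rfl

@[fun_prop]
theorem FP.not {c : Z → Bool} (hc : FP c) : FP fun z => !c z :=
  (FP.cond hc (FP.const false) (FP.const true)).of_eq fun z => by cases c z <;> rfl

@[fun_prop]
theorem FP.cons {f : Z → A} {l : Z → List A} (hf : FP f) (hl : FP l) : FP fun z => f z :: l z :=
  FP.comp (f := fun p : A × List A => p.1 :: p.2) (FP.of_enc_id fun _ => rfl) (hf.prodMk hl)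

@[fun_prop]
theorem FP.listTail {l : Z → List A} (hl : FP l) : FP fun z => (l z).tail :=
  FP.comp (f := List.tail) (FP.tail.of_enc_eq fun l => by cases l <;> rfl) hl

theorem size_append (l l' : List A) : size (l ++ l') + 1 = size l + size l' := by
  induction l with
  | nil => simp [Nat.add_comm]
  | cons a l ih => simp; omega

theorem size_reverse (l : List A) : size l.reverse = size l := by
  induction l with
  | nil => rfl
  | cons a l ih =>
    have := size_append l.reverse [a]
    simp only [List.reverse_cons, size_cons, size_nil] at *
    omega

theorem size_le_of_sublist {l l' : List A} (h : l'.Sublist l) : size l' ≤ size l := by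
  induction h with
  | slnil => exact le_rfl
  | cons a _ ih => simp; omega
  | cons_cons a _ ih => simp; omega

theorem size_le_of_mem {l : List A} {a : A} (h : a ∈ l) : size a ≤ size l := by
  induction l with
  | nil => simp at h
  | cons b l ih =>
    rcases List.mem_cons.1 h with rfl | h
    · simp; omega
    · have := ih h; simp; omega

@[fun_prop]
theorem FP.reverse {l : Z → List A} (hl : FP l) : FP fun z => (l z).reverse := by
  have h : FP fun l : List A => l.foldl (fun acc b => b :: acc) [] :=
    FP.foldl (h := fun _ acc b => b :: acc) (by fun_prop) (FP.const []) FP.id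
      ⟨Polynomial.X, fun l l' h => by
        rw [Polynomial.eval_X, List.foldl_flip_cons_eq_append', List.append_nil, size_reverse]
        exact size_le_of_sublist h.sublist⟩
  exact (h.comp hl).of_eq fun z => by simp

/-- Right folds, provided that the intermediate results have polynomial size. -/
theorem FP.foldr {h : Z → B → A → A} {init : Z → A} {l : Z → List B}
    (hh : FP fun q : Z × B × A => h q.1 q.2.1 q.2.2) (hi : FP init) (hl : FP l)
    (hS : ∃ S : Polynomial ℕ, ∀ z l', l' <:+ l z →
      size (l'.foldr (h z) (init z)) ≤ S.eval (size z)) :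
    FP fun z => (l z).foldr (h z) (init z) := by
  obtain ⟨S, hS⟩ := hS
  refine (FP.foldl (h := fun z a b => h z b a) (init := init) (l := fun z => (l z).reverse)
    (FP.comp (f := fun q : Z × B × A => h q.1 q.2.1 q.2.2)
      (g := fun q : Z × A × B => (q.1, q.2.2, q.2.1)) hh (by fun_prop))
    hi (by fun_prop) ⟨S, fun z l' h' => ?_⟩).of_eq fun z => by simp
  have := hS z l'.reverse (by rwa [← List.reverse_prefix, List.reverse_reverse])
  simpa using this

@[fun_prop]
theorem FP.append {l l' : Z → List A} (hl : FP l) (hl' : FP l') : FP fun z => l z ++ l' z := by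
  have h : FP fun p : List A × List A => p.1.foldr (fun b acc => b :: acc) p.2 :=
    FP.foldr (h := fun _ b acc => b :: acc) (by fun_prop) (by fun_prop) (by fun_prop)
      ⟨Polynomial.X, fun p u h => by
        have h₁ := size_append u p.2
        have h₂ := size_le_of_sublist h.sublist
        have h₃ : u.foldr (fun b acc => b :: acc) p.2 = u ++ p.2 := by simp
        rw [Polynomial.eval_X, h₃, size_prod]
        omega⟩
  exact (h.comp (hl.prodMk hl')).of_eq fun z => by simp

/-- Right folds in which each step adds a bounded number of symbols to the result. -/
theorem FP.foldr_of_size_le {h : Z → B → A → A} {init : Z → A} {l : Z → List B}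
    (hh : FP fun q : Z × B × A => h q.1 q.2.1 q.2.2) (hi : FP init) (hl : FP l)
    (hS : ∃ S : Polynomial ℕ, ∀ z a, ∀ b ∈ l z, size (h z b a) ≤ size a + S.eval (size z)) :
    FP fun z => (l z).foldr (h z) (init z) := by
  obtain ⟨S, hS⟩ := hS
  obtain ⟨S₁, hS₁⟩ := hi.size_le
  obtain ⟨S₂, hS₂⟩ := hl.size_le
  refine FP.foldr hh hi hl ⟨S₁ + S₂ * S, fun z l' hl' => ?_⟩
  have key : size (l'.foldr (h z) (init z)) ≤ size (init z) + l'.length * S.eval (size z) := by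
    have hm : ∀ b ∈ l', b ∈ l z := fun b hb => hl'.subset hb
    clear hl'
    induction l' with
    | nil => simp
    | cons b l' ih =>
      have h₁ := hS z (l'.foldr (h z) (init z)) b (hm b (by simp))
      have h₂ := ih fun b hb => hm b (by simp [hb])
      rw [List.foldr_cons, List.length_cons, Nat.succ_mul]
      omega
  have h₁ : l'.length ≤ S₂.eval (size z) :=
    (hl'.length_le.trans (length_le_size _)).trans (hS₂ z)
  have h₂ := Nat.mul_le_mul_right (S.eval (size z)) h₁
  have h₃ := hS₁ z
  simp only [Polynomial.eval_add, Polynomial.eval_mul]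
  omega

/-- Left folds in which each step adds a bounded number of symbols to the result. -/
theorem FP.foldl_of_size_le {h : Z → A → B → A} {init : Z → A} {l : Z → List B}
    (hh : FP fun q : Z × A × B => h q.1 q.2.1 q.2.2) (hi : FP init) (hl : FP l)
    (hS : ∃ S : Polynomial ℕ, ∀ z a, ∀ b ∈ l z, size (h z a b) ≤ size a + S.eval (size z)) :
    FP fun z => (l z).foldl (h z) (init z) := by
  obtain ⟨S, hS⟩ := hS
  refine (FP.foldr_of_size_le (h := fun z b a => h z a b) (init := init)
    (l := fun z => (l z).reverse)
    (FP.comp (f := fun q : Z × A × B => h q.1 q.2.1 q.2.2)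
      (g := fun q : Z × B × A => (q.1, q.2.2, q.2.1)) hh (by fun_prop))
    hi (by fun_prop) ⟨S, fun z a b hb => hS z a b (by simpa using hb)⟩).of_eq fun z => by simp

/-- The values of a function in `FP` at the members of a list have polynomial size. -/
theorem FP.exists_size_le_of_mem {l : Z → List B} {f : Z → B → A} (hl : FP l)
    (hf : FP fun q : Z × B => f q.1 q.2) :
    ∃ S : Polynomial ℕ, ∀ z, ∀ b ∈ l z, size (f z b) ≤ S.eval (size z) := by
  obtain ⟨S, hS⟩ := hf.size_le
  obtain ⟨S', hS'⟩ := hl.size_le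
  refine ⟨S.comp (Polynomial.X + S' + 1), fun z b hb => ?_⟩
  refine (hS (z, b)).trans ?_
  rw [Polynomial.eval_comp]
  refine eval_le_eval S ?_
  have := size_le_of_mem hb
  have := hS' z
  simp only [size_prod, Polynomial.eval_add, Polynomial.eval_X, Polynomial.eval_one]
  omega

@[fun_prop]
theorem FP.map {l : Z → List B} {f : Z → B → A} (hl : FP l)
    (hf : FP fun q : Z × B => f q.1 q.2) : FP fun z => (l z).map (f z) := by
  obtain ⟨S, hS⟩ := FP.exists_size_le_of_mem hl hf
  refine (FP.foldr_of_size_le (h := fun z b a => f z b :: a) (init := fun _ => []) (l := l)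
    ?_ (FP.const []) hl ⟨S + 1, fun z a b hb => ?_⟩).of_eq fun z => ?_
  · exact FP.cons (FP.comp (f := fun q : Z × B => f q.1 q.2)
      (g := fun q : Z × B × List A => (q.1, q.2.1)) hf (by fun_prop)) (by fun_prop)
  · have := hS z b hb
    simp
    omega
  · induction l z <;> simp_all

@[fun_prop]
theorem FP.filter {l : Z → List B} {p : Z → B → Bool} (hl : FP l)
    (hp : FP fun q : Z × B => p q.1 q.2) : FP fun z => (l z).filter (p z) := by
  obtain ⟨S, hS⟩ := FP.exists_size_le_of_mem hl (f := fun _ b => b) (by fun_prop)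
  refine (FP.foldr_of_size_le (h := fun z b a => bif p z b then b :: a else a)
    (init := fun _ => []) (l := l)
    ?_ (FP.const []) hl ⟨S + 1, fun z a b hb => ?_⟩).of_eq fun z => ?_
  · exact FP.cond (FP.comp (f := fun q : Z × B => p q.1 q.2)
      (g := fun q : Z × B × List B => (q.1, q.2.1)) hp (by fun_prop)) (by fun_prop) (by fun_prop)
  · have := hS z b hb
    cases p z b <;> simp
    omega
  · induction l z with
    | nil => rfl
    | cons b l ih => cases h : p z b <;> simp_all

@[fun_prop]
theorem FP.any {l : Z → List B} {p : Z → B → Bool} (hl : FP l)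
    (hp : FP fun q : Z × B => p q.1 q.2) : FP fun z => (l z).any (p z) := by
  refine (FP.foldr (h := fun z b a => p z b || a) (init := fun _ => false) (l := l)
    ?_ (FP.const _) hl ⟨3, fun z l' _ => ?_⟩).of_eq fun z => ?_
  · exact FP.or (FP.comp (f := fun q : Z × B => p q.1 q.2)
      (g := fun q : Z × B × Bool => (q.1, q.2.1)) hp (by fun_prop)) (by fun_prop)
  · exact (size_bool_le _).trans (by simp)
  · induction l z <;> simp_all

@[fun_prop]
theorem FP.all {l : Z → List B} {p : Z → B → Bool} (hl : FP l)
    (hp : FP fun q : Z × B => p q.1 q.2) : FP fun z => (l z).all (p z) :=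
  (FP.not (FP.any (p := fun z b => !p z b) hl (FP.not hp))).of_eq fun _ =>
    List.all_eq_not_any_not.symm

@[fun_prop]
theorem FP.flatten {l : Z → List (List A)} (hl : FP l) : FP fun z => (l z).flatten := by
  obtain ⟨S, hS⟩ := FP.exists_size_le_of_mem hl (f := fun _ b => b) (by fun_prop)
  refine (FP.foldr_of_size_le (h := fun _ b a => b ++ a) (init := fun _ => []) (l := l)
    (by fun_prop) (FP.const []) hl ⟨S, fun z a b hb => ?_⟩).of_eq fun z => ?_
  · have := hS z b hb
    have := size_append b a
    omega
  · induction l z <;> simp_all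

@[fun_prop]
theorem FP.flatMap {l : Z → List B} {f : Z → B → List A} (hl : FP l)
    (hf : FP fun q : Z × B => f q.1 q.2) : FP fun z => (l z).flatMap (f z) :=
  (FP.flatten (FP.map hl hf)).of_eq fun _ => List.flatMap_def.symm

@[fun_prop]
theorem FP.isEmpty {l : Z → List A} (hl : FP l) : FP fun z => (l z).isEmpty :=
  (FP.not (FP.any (p := fun _ _ => true) hl (FP.const true))).of_eq fun z => by cases l z <;> simp

@[fun_prop]
theorem FP.headD {l : Z → List A} {d : Z → A} (hl : FP l) (hd : FP d) :
    FP fun z => (l z).headD (d z) := by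
  obtain ⟨S, hS⟩ := FP.exists_size_le_of_mem hl (f := fun _ b => b) (by fun_prop)
  obtain ⟨S', hS'⟩ := hd.size_le
  refine (FP.foldr (h := fun _ b _ => b) (init := d) (l := l)
    (by fun_prop) hd hl ⟨S + S', fun z l' h => ?_⟩).of_eq fun z => ?_
  · rw [Polynomial.eval_add]
    cases l' with
    | nil => exact (hS' z).trans (Nat.le_add_left _ _)
    | cons b l' => exact (hS z b (h.subset (by simp))).trans (Nat.le_add_right _ _)
  · cases l z <;> rfl

end Combinators

/-! ### Equality tests in polynomial time -/

/-- Equality of elements of `A` can be decided in polynomial time. -/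
class EqFP (A : Type) [Enc A] [DecidableEq A] : Prop where
  fp : FP fun p : A × A => decide (p.1 = p.2)

@[fun_prop]
theorem FP.decide_eq {Z A : Type} [Enc Z] [Enc A] [DecidableEq A] [EqFP A] {f g : Z → A}
    (hf : FP f) (hg : FP g) : FP fun z => decide (f z = g z) :=
  EqFP.fp.comp (hf.prodMk hg)

theorem EqFP.of_injective {A B : Type} [Enc A] [Enc B] [DecidableEq A] [DecidableEq B] [EqFP B]
    {f : A → B} (hf : FP f) (h : Function.Injective f) : EqFP A :=
  ⟨(FP.decide_eq (f := fun p : A × A => f p.1) (g := fun p => f p.2) (hf.comp (by fun_prop))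
    (hf.comp (by fun_prop))).of_eq fun p => by simp [h.eq_iff]⟩

instance : EqFP Bool :=
  ⟨(FP.cond (c := fun p : Bool × Bool => p.1) (f := fun p => p.2) (g := fun p => !p.2)
    (by fun_prop) (by fun_prop) (by fun_prop)).of_eq fun p => by
      rcases p with ⟨_ | _, _ | _⟩ <;> rfl⟩

instance {A B : Type} [Enc A] [Enc B] [DecidableEq A] [DecidableEq B] [EqFP A] [EqFP B] :
    EqFP (A × B) :=
  ⟨(FP.and (c := fun p : (A × B) × (A × B) => decide (p.1.1 = p.2.1))
    (d := fun p : (A × B) × (A × B) => decide (p.1.2 = p.2.2)) (by fun_prop)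
    (by fun_prop)).of_eq fun p => by simp [Prod.ext_iff]⟩

/-- Compare two lists entry by entry; the second list is consumed along the first one. The result
is meaningful if the lists have the same length. -/
def zipAll {A : Type} (P : A → A → Bool) (l l' : List A) : Bool :=
  (l.foldl (fun s a => (s.1 && P a (s.2.headD a), s.2.tail)) (true, l')).1

theorem zipAll_eq {A : Type} (P : A → A → Bool) (l l' : List A) (h : l.length = l'.length) :
    zipAll P l l' = (l.zip l').all fun p => P p.1 p.2 := by
  have key : ∀ (b : Bool) (l l' : List A), l.length = l'.length →
      (l.foldl (fun s a => (s.1 && P a (s.2.headD a), s.2.tail)) (b, l')).1 =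
        (b && (l.zip l').all fun p => P p.1 p.2) := by
    intro b l
    induction l generalizing b with
    | nil => intro l' h; cases l' <;> simp_all
    | cons a l ih =>
      intro l' h
      cases l' with
      | nil => simp at h
      | cons a' l' =>
        rw [List.foldl_cons, ih _ _ (by simpa using h)]
        simp [Bool.and_assoc]
  exact (key true l l' h).trans (Bool.true_and _)

theorem size_tail_le {A : Type} [Enc A] (l : List A) : size l.tail ≤ size l :=
  size_le_of_sublist (List.tail_sublist l)

@[fun_prop]
theorem FP.zipAll {Z A : Type} [Enc Z] [Enc A] {P : Z → A → A → Bool} {l l' : Z → List A}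
    (hP : FP fun q : Z × A × A => P q.1 q.2.1 q.2.2) (hl : FP l) (hl' : FP l') :
    FP fun z => zipAll (P z) (l z) (l' z) := by
  refine FP.fst (FP.foldl_of_size_le
    (h := fun z (s : Bool × List A) a => (s.1 && P z a (s.2.headD a), s.2.tail)) ?_ (by fun_prop)
    hl ⟨3, fun z s b _ => ?_⟩)
  · exact FP.prodMk (FP.and (by fun_prop) (FP.comp (f := fun q : Z × A × A => P q.1 q.2.1 q.2.2)
      (g := fun q : Z × (Bool × List A) × A => (q.1, q.2.2, q.2.1.2.headD q.2.2)) hP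
      (by fun_prop))) (by fun_prop)
  · have h₁ := size_tail_le s.2
    have h₂ := size_bool_le (s.1 && P z b (s.2.headD b))
    simp only [size_prod, Polynomial.eval_ofNat]
    omega

/-- Two lists are equal if in a comparison entry by entry the second list is used up precisely at
the end of the first one. -/
instance {A : Type} [Enc A] [DecidableEq A] [EqFP A] : EqFP (List A) := by
  constructor
  have h : FP fun p : List A × List A => p.1.foldl (fun (s : Bool × List A) a =>
      (s.1 && !s.2.isEmpty && decide (a = s.2.headD a), s.2.tail)) (true, p.2) := by
    refine FP.foldl_of_size_le (h := fun _ (s : Bool × List A) a =>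
      (s.1 && !s.2.isEmpty && decide (a = s.2.headD a), s.2.tail)) (by fun_prop) (by fun_prop)
      (by fun_prop) ⟨3, fun z s b _ => ?_⟩
    have h₁ := size_tail_le s.2
    have h₂ := size_bool_le (s.1 && !s.2.isEmpty && decide (b = s.2.headD b))
    simp only [size_prod, Polynomial.eval_ofNat]
    omega
  refine (FP.and (FP.fst h) (FP.isEmpty (FP.snd h))).of_eq fun p => ?_
  obtain ⟨l, l'⟩ := p
  have key : ∀ (b : Bool) (l l' : List A), (fun s : Bool × List A => s.1 && s.2.isEmpty)
      (l.foldl (fun (s : Bool × List A) a =>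
        (s.1 && !s.2.isEmpty && decide (a = s.2.headD a), s.2.tail)) (b, l')) =
        (b && decide (l = l')) := by
    intro b l
    induction l generalizing b with
    | nil => intro l'; cases l' <;> simp
    | cons a l ih =>
      intro l'
      rw [List.foldl_cons, ih]
      cases l' with
      | nil => simp
      | cons a' l' =>
        simp only [List.isEmpty_cons, Bool.not_false, Bool.and_true, List.headD_cons,
          List.tail_cons, List.cons.injEq, Bool.decide_and, Bool.and_assoc]
        congr
  exact (key true l l').trans (Bool.true_and _)

/-! ### From structured programs to Turing machines -/

/-- Replace the code of a Boolean on the stack `0` by the Boolean. -/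
def Prog.output : Prog :=
  .case 0 fun o => match o with
    | some true => .seq (.clear 0) (.push 0 true)
    | _ => .push 0 false

theorem runLe_output (b : Bool) :
    RunLe .output (update (fun _ => []) 0 (enc b).code) (update (fun _ => []) 0 [b]) 7 := by
  refine RunLe.case (n := 6) ?_
  cases b with
  | false =>
    refine (RunLe.push _ 0 false).of_eq ?_ (by omega)
    simp [enc, Data.code]
  | true =>
    refine ((runLe_clear 0 _).seq (RunLe.push _ 0 true)).of_eq ?_ ?_
    · simp
    · simp [enc, Data.code]

/-- A predicate on words in `FP` is decided by a Turing machine in polynomial time. -/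
theorem FP.polyTime {G : Type} [Fintype G] [Enc G] {f : List G → Bool} (hf : FP f) {α : Type}
    (e : α → List G) : PolyTime e fun a => f (e a) := by
  obtain ⟨p, M, T, hp, h⟩ := hf
  have hcode : ∀ w : List G, (enc w).code =
      (w.map fun a => true :: (enc a).code).flatten ++ [false] := by
    intro w
    induction w with
    | nil => rfl
    | cons a w ih => rw [code_cons, ih]; simp
  obtain ⟨C, hC⟩ : ∃ C, ∀ w : List G, size w ≤ C * w.length + 1 := by
    refine ⟨Finset.univ.sup (fun a : G => size a) + 1, fun w => ?_⟩
    induction w with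
    | nil => simp
    | cons a w ih =>
      have : size a ≤ Finset.univ.sup (fun a : G => size a) :=
        Finset.le_sup (f := fun a : G => size a) (Finset.mem_univ a)
      rw [List.length_cons, Nat.mul_succ, size_cons]
      omega
  refine polyTime_of_run (fun a => true :: (enc a).code)
    (.seq (.push 0 false) (.seq (.rev 1 0) (.seq p .output))) (M + 2)
    ⟨by simp [Prog.Bounded], ⟨by omega, fun _ => by simp [Prog.Bounded]⟩, hp.mono (by omega),
      by omega, fun o => ?_⟩ f
    (2 * (Polynomial.C C * Polynomial.X + 1) + T.comp (Polynomial.C C * Polynomial.X + 1) + 10)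
    (fun w => ?_) e
  · rcases o with _ | _ | _ <;> simp [Prog.Bounded, Prog.clear]
  · have h₁ := RunLe.push (update (fun _ => [])
      1 (w.map fun a => true :: (enc a).code).flatten.reverse) 0 false
    have h₂ := runLe_rev (r := 1) (r' := 0) (by omega) (update (update (fun _ => [])
      1 (w.map fun a => true :: (enc a).code).flatten.reverse) 0 [false])
    have h₃ := h w (update (fun _ => []) 0 (enc w).code) (by simp)
      fun i hi _ => Function.update_of_ne (by omega) ..
    have e₂ : update (update (update (update (fun _ => [])
        1 (w.map fun a => true :: (enc a).code).flatten.reverse) 0 [false]) 1 []) 0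
          ((w.map fun a => true :: (enc a).code).flatten ++ [false]) =
        update (fun _ => []) 0 (enc w).code := by
      rw [hcode]
      funext i
      simp only [Function.update_apply]
      split_ifs <;> simp_all
    simp at h₁ h₂ h₃
    simp at e₂
    rw [e₂] at h₂
    have h₄ := runLe_output (f w)
    have hn : ((w.map fun a => true :: (enc a).code).flatten.length) + 1 = size w := by
      rw [size, hcode]
      simp
    obtain ⟨t, ht, hr⟩ := h₁.seq (h₂.seq (h₃.seq h₄))
    refine ⟨t, ht.trans ?_, hr⟩
    have h₅ := eval_le_eval T (hC w)
    have h₆ := hC w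
    simp at hn
    simp only [Polynomial.eval_add, Polynomial.eval_mul, Polynomial.eval_X, Polynomial.eval_C,
      Polynomial.eval_ofNat, Polynomial.eval_one, Polynomial.eval_comp]
    omega

end TreeRewriting

namespace TreeRewriting

open Enc (enc)

/-! ### Letters and tokens -/

/-- The letters as bit strings. Precisely the bits have strings of length one. -/
def letterCode : Letter → List Bool
  | .bit b => [b]
  | .sym => [false, false]
  | .arity => [false, true]
  | .state => [true, false]
  | .accept => [true, true]
  | .var => [false, false, false]
  | .arrow => [false, false, true]
  | .close => [false, true, false]
  | .sep => [false, true, true]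

instance : Enc Letter := ⟨fun a => enc (letterCode a)⟩

theorem fp_letterCode : FP letterCode := FP.of_enc_id fun _ => rfl

instance : EqFP Letter := EqFP.of_injective fp_letterCode fun a b h => by
  rcases a with (_ | _) | _ <;> rcases b with (_ | _) | _ <;> simp_all [letterCode]

/-- A letter of an input with certificate is represented by its origin and a bit string. -/
instance : Enc (Letter ⊕ Bool) :=
  ⟨fun x => enc (match x with
    | .inl a => (false, letterCode a)
    | .inr b => (true, [b]))⟩

/-- Forget whether a letter belongs to the input or to the certificate. -/
def asLetter : Letter ⊕ Bool → Letter
  | .inl a => a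
  | .inr b => .bit b

/-- The value of a binary digit; the value at other letters does not matter. -/
def bitValue (a : Letter) : Bool := (letterCode a).headD false

/-- Only the binary digits have codes of length one. -/
def isBit (a : Letter) : Bool := (letterCode a).tail.isEmpty

@[fun_prop]
theorem FP.bitValue {Z : Type} [Enc Z] {a : Z → Letter} (ha : FP a) : FP fun z => bitValue (a z) :=
  FP.headD (fp_letterCode.comp ha) (FP.const _)

@[fun_prop]
theorem FP.isBit {Z : Type} [Enc Z] {a : Z → Letter} (ha : FP a) : FP fun z => isBit (a z) :=
  FP.isEmpty (FP.listTail (fp_letterCode.comp ha))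

@[fun_prop]
theorem FP.isRight {Z : Type} [Enc Z] {a : Z → Letter ⊕ Bool} (ha : FP a) :
    FP fun z => (a z).isRight :=
  FP.comp (f := Sum.isRight) (FP.of_enc_eq FP.head (by rintro (_ | _ | _) <;> rfl)) ha

@[fun_prop]
theorem FP.asLetter {Z : Type} [Enc Z] {a : Z → Letter ⊕ Bool} (ha : FP a) :
    FP fun z => asLetter (a z) :=
  FP.comp (f := TreeRewriting.asLetter)
    (FP.of_enc_eq FP.tail (by rintro (_ | _ | _) <;> rfl)) ha

/-- Numbers occurring in an input are handled in their binary notation. -/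
abbrev Name : Type := List Bool

/-- A letter together with the number that follows it. -/
abbrev Token : Type := Letter × Name

/-- One step in reading a word from the right: the state holds the digits of the current number and
the tokens read so far. -/
def tokenStep (a : Letter) (s : Name × List Token) : Name × List Token :=
  bif isBit a then (bitValue a :: s.1, s.2) else ([], (a, s.1) :: s.2)

def tokens (w : List Letter) : List Token := (w.foldr tokenStep ([], [])).2

@[fun_prop]
theorem FP.tokens {Z : Type} [Enc Z] {w : Z → List Letter} (hw : FP w) :
    FP fun z => tokens (w z) := by
  refine FP.comp (f := TreeRewriting.tokens) (FP.snd ?_) hw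
  refine FP.foldr_of_size_le (h := fun _ => tokenStep) (by unfold tokenStep; fun_prop)
    (FP.const _) FP.id ⟨Polynomial.X + 5, fun w s a ha => ?_⟩
  have h₁ := size_le_of_mem ha
  have h₂ := size_bool_le (TreeRewriting.bitValue a)
  unfold tokenStep
  cases TreeRewriting.isBit a <;> simp [size_prod] <;> omega

/-- One step in splitting a list from the right: the state holds the current section and the
following ones. -/
def sectionStep (t : Token) (s : List Token × List (List Token)) : List Token × List (List Token) :=
  bif decide (t.1 = .sep) then ([], s.1 :: s.2) else (t :: s.1, s.2)

/-- The maximal sublists without separators. -/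
def sections (l : List Token) : List (List Token) :=
  let s := l.foldr sectionStep ([], [])
  s.1 :: s.2

@[fun_prop]
theorem FP.sections {Z : Type} [Enc Z] {l : Z → List Token} (hl : FP l) :
    FP fun z => sections (l z) := by
  refine FP.comp (f := TreeRewriting.sections) ?_ hl
  have h : FP fun l : List Token => l.foldr sectionStep ([], []) := by
    refine FP.foldr_of_size_le (h := fun _ => sectionStep) (by unfold sectionStep; fun_prop)
      (FP.const _) FP.id ⟨Polynomial.X + 5, fun w s a ha => ?_⟩
    have h₁ := size_le_of_mem ha
    unfold sectionStep
    cases decide (a.1 = .sep) <;> simp [size_prod] at * <;> omega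
  exact FP.cons h.fst h.snd

/-! ### Reading the automaton -/

/-- The numbers of all states, in the order of the input. -/
def stateNames (l : List Token) : List Name :=
  (l.filter fun t => decide (t.1 = .state)).map fun t => t.2

@[fun_prop]
theorem FP.stateNames {Z : Type} [Enc Z] {l : Z → List Token} (hl : FP l) :
    FP fun z => stateNames (l z) := by
  unfold TreeRewriting.stateNames
  fun_prop

/-- One step in reading the states from the right: the state records whether the last token was a
mark, and collects the names that precede marks. -/
def acceptStep (t : Token) (s : Bool × List Name) : Bool × List Name :=
  bif decide (t.1 = .accept) then (true, s.2) else (false, bif s.1 then t.2 :: s.2 else s.2)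

/-- The names of the states that are followed by a mark. -/
def acceptNames (l : List Token) : List Name := (l.foldr acceptStep (false, [])).2

@[fun_prop]
theorem FP.acceptNames {Z : Type} [Enc Z] {l : Z → List Token} (hl : FP l) :
    FP fun z => acceptNames (l z) := by
  refine FP.comp (f := TreeRewriting.acceptNames) (FP.snd ?_) hl
  refine FP.foldr_of_size_le (h := fun _ => acceptStep) (by unfold acceptStep; fun_prop)
    (FP.const _) FP.id ⟨Polynomial.X + 5, fun w s a ha => ?_⟩
  have h₁ := size_le_of_mem ha
  have h₂ := one_le_size s.1
  unfold acceptStep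
  cases decide (a.1 = .accept) <;> cases s.1 <;>
    simp [size_prod, size_true, size_false] at * <;> omega

/-- A transition is read as its function symbol and the list of its states in reverse order, so that
the result comes first. -/
abbrev Transition : Type := Name × List Name

/-- One step in reading the transition table from the left: the state holds the current transition
and those read so far. -/
def tableStep (s : Transition × List Transition) (t : Token) : Transition × List Transition :=
  bif decide (t.1 = .sym) then ((t.2, []), s.2) else
  bif decide (t.1 = .state) then ((s.1.1, t.2 :: s.1.2), s.2) else
  bif decide (t.1 = .close) then (([], []), s.1 :: s.2) else s

/-- The transition table. -/
def table (l : List Token) : List Transition := (l.foldl tableStep (([], []), [])).2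

@[fun_prop]
theorem FP.table {Z : Type} [Enc Z] {l : Z → List Token} (hl : FP l) : FP fun z => table (l z) := by
  refine FP.comp (f := TreeRewriting.table) (FP.snd ?_) hl
  refine FP.foldl_of_size_le (h := fun _ => tableStep) (by unfold tableStep; fun_prop)
    (FP.const _) FP.id ⟨Polynomial.X + 5, fun w s a ha => ?_⟩
  have h₁ := size_le_of_mem ha
  unfold tableStep
  cases decide (a.1 = .sym) <;> cases decide (a.1 = .state) <;> cases decide (a.1 = .close) <;>
    simp [size_prod] at * <;> omega

/-! ### Evaluation of terms -/

/-- A word that is not the binary notation of a number: the result of a failed evaluation. -/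
def junk : Name := [false]

/-- The state that results from a function symbol and a list of states in reverse order. -/
def lookupTransition (T : List Transition) (f : Name) (qs : List Name) : Name :=
  ((T.filter fun t => decide (t.1 = f) && decide (t.2.tail = qs)).map fun t =>
    t.2.headD junk).headD junk

/-- A partial assignment of states to variables. -/
abbrev Assignment : Type := List (Name × Name)

/-- The first state that is assigned to the variable, or `junk` if there is none. -/
def lookupVariable (τ : Assignment) (x : Name) : Name :=
  ((τ.filter fun e => decide (e.1 = x)).map fun e => e.2).headD junk

@[fun_prop]
theorem FP.lookupTransition {Z : Type} [Enc Z] {T : Z → List Transition} {f : Z → Name}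
    {qs : Z → List Name} (hT : FP T) (hf : FP f) (hqs : FP qs) :
    FP fun z => lookupTransition (T z) (f z) (qs z) := by
  unfold TreeRewriting.lookupTransition
  fun_prop

@[fun_prop]
theorem FP.lookupVariable {Z : Type} [Enc Z] {τ : Z → Assignment} {x : Z → Name}
    (hτ : FP τ) (hx : FP x) : FP fun z => lookupVariable (τ z) (x z) := by
  unfold TreeRewriting.lookupVariable
  fun_prop

/-- A configuration of the evaluation of terms: the function symbol whose arguments are being
evaluated with the values found so far in reverse order, the stack of the enclosing function symbols
in the same form, and the pairs of values of the rules that have been evaluated completely. The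
outermost frame is for the two sides of a rule. -/
abbrev EvalState : Type := Transition × List Transition × List (Name × Name)

/-- One step of the evaluation of terms: a function symbol opens a frame, a variable contributes its
value to the current frame, and a closing bracket either completes a function symbol or, when no
frame is open, a rule. -/
def evalStep (T : List Transition) (τ : Assignment) (s : EvalState) (t : Token) : EvalState :=
  bif decide (t.1 = .sym) then ((t.2, []), s.1 :: s.2.1, s.2.2) else
  bif decide (t.1 = .var) then ((s.1.1, lookupVariable τ t.2 :: s.1.2), s.2) else
  bif decide (t.1 = .close) then
    bif s.2.1.isEmpty then
      (([], []), [], (s.1.2.tail.headD junk, s.1.2.headD junk) :: s.2.2)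
    else
      (((s.2.1.headD ([], [])).1,
        lookupTransition T s.1.1 s.1.2 :: (s.2.1.headD ([], [])).2), s.2.1.tail, s.2.2)
  else s

/-- The pairs of states to which the two sides of the rules evaluate under an assignment. -/
def ruleValues (T : List Transition) (τ : Assignment) (l : List Token) : List (Name × Name) :=
  (l.foldl (evalStep T τ) (([], []), [], [])).2.2

theorem size_headD_le {A : Type} [Enc A] (l : List A) (d : A) :
    size (l.headD d) ≤ size l + size d := by
  cases l <;> simp
  omega

theorem size_lookupTransition_le (T : List Transition) (f : Name) (qs : List Name) :
    size (lookupTransition T f qs) ≤ size T + 10 := by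
  have hj : size junk = 3 := rfl
  unfold lookupTransition
  cases h : T.filter fun t => decide (t.1 = f) && decide (t.2.tail = qs) with
  | nil => simp [hj]
  | cons t l =>
    have ht : t ∈ T := List.mem_of_mem_filter (by rw [h]; simp)
    have h₁ := size_le_of_mem ht
    have h₂ := size_headD_le t.2 junk
    rw [size_prod] at h₁
    simp at *
    omega

theorem size_lookupVariable_le (τ : Assignment) (x : Name) :
    size (lookupVariable τ x) ≤ size τ + 10 := by
  have hj : size junk = 3 := rfl
  unfold lookupVariable
  cases h : τ.filter fun e => decide (e.1 = x) with
  | nil => simp [hj]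
  | cons t l =>
    have ht : t ∈ τ := List.mem_of_mem_filter (by rw [h]; simp)
    have h₁ := size_le_of_mem ht
    rw [size_prod] at h₁
    simp at *
    omega

theorem size_evalStep_le (T : List Transition) (τ : Assignment) (s : EvalState) (t : Token) :
    size (evalStep T τ s t) ≤ size s + (size T + size τ + size t + 20) := by
  obtain ⟨⟨f, qs⟩, st, out⟩ := s
  have h₁ := size_lookupTransition_le T f qs
  have h₂ := size_lookupVariable_le τ t.2
  have hj : size junk = 3 := rfl
  unfold evalStep
  cases decide (t.1 = .sym)
  · cases decide (t.1 = .var)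
    · cases decide (t.1 = .close)
      · simp
      · rcases st with _ | ⟨⟨g, rs⟩, st⟩
        · rcases qs with _ | ⟨q, _ | ⟨q', qs⟩⟩ <;> simp [size_prod, hj] <;> omega
        · simp [size_prod]
          omega
    · simp [size_prod]
      omega
  · simp [size_prod]
    omega

@[fun_prop]
theorem FP.ruleValues {Z : Type} [Enc Z] {T : Z → List Transition} {τ : Z → Assignment}
    {l : Z → List Token} (hT : FP T) (hτ : FP τ) (hl : FP l) :
    FP fun z => ruleValues (T z) (τ z) (l z) := by
  refine FP.comp (f := fun q : List Transition × Assignment × List Token =>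
    TreeRewriting.ruleValues q.1 q.2.1 q.2.2) (g := fun z => (T z, τ z, l z)) (FP.snd (FP.snd ?_))
    (by fun_prop)
  refine FP.foldl_of_size_le (h := fun q : List Transition × Assignment × List Token =>
    evalStep q.1 q.2.1) (by unfold evalStep; fun_prop) (FP.const _) (by fun_prop)
    ⟨Polynomial.X + 20, fun q s t ht => ?_⟩
  have h₁ := size_le_of_mem ht
  have h₂ := size_evalStep_le q.1 q.2.1 s t
  simp only [size_prod, Polynomial.eval_add, Polynomial.eval_X, Polynomial.eval_ofNat] at *
  omega

/-! ### Saturation -/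

/-- The pair `(p, q)` is in the list `P`. -/
def related (P : List (Name × Name)) (p q : Name) : Bool := P.any fun e => decide (e = (p, q))

/-- The pair `e` is obtained in one step from the pairs in `P`: either by applying a function symbol
to pairs in `P`, or by applying a rule under an assignment of states whose diagonal pairs are
in `P`. -/
def derivable (T : List Transition) (I : List (Assignment × List (Name × Name)))
    (P : List (Name × Name)) (e : Name × Name) : Bool :=
  (T.any fun t => T.any fun t' => decide (t.1 = t'.1) && decide (t.2.headD junk = e.1) &&
    decide (t'.2.headD junk = e.2) && zipAll (related P) t.2.tail t'.2.tail) ||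
  I.any fun i => (i.1.all fun x => related P x.2 x.2) && related i.2 e.1 e.2

/-- The pairs in `U` that are derivable in as many steps as `U` has elements. -/
def saturate (T : List Transition) (I : List (Assignment × List (Name × Name)))
    (U : List (Name × Name)) : List (Name × Name) :=
  U.foldl (fun P _ => U.filter (derivable T I P)) []

@[fun_prop]
theorem FP.related {Z : Type} [Enc Z] {P : Z → List (Name × Name)} {p q : Z → Name}
    (hP : FP P) (hp : FP p) (hq : FP q) : FP fun z => related (P z) (p z) (q z) := by
  unfold TreeRewriting.related
  fun_prop

@[fun_prop]
theorem FP.derivable {Z : Type} [Enc Z] {T : Z → List Transition}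
    {I : Z → List (Assignment × List (Name × Name))} {P : Z → List (Name × Name)}
    {e : Z → Name × Name} (hT : FP T) (hI : FP I) (hP : FP P) (he : FP e) :
    FP fun z => derivable (T z) (I z) (P z) (e z) := by
  unfold TreeRewriting.derivable
  fun_prop

@[fun_prop]
theorem FP.saturate {Z : Type} [Enc Z] {T : Z → List Transition}
    {I : Z → List (Assignment × List (Name × Name))} {U : Z → List (Name × Name)}
    (hT : FP T) (hI : FP I) (hU : FP U) : FP fun z => saturate (T z) (I z) (U z) := by
  obtain ⟨S, hS⟩ := hU.size_le
  refine FP.foldl (h := fun z P _ => (U z).filter (TreeRewriting.derivable (T z) (I z) P))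
    (by fun_prop) (FP.const _) hU ⟨S, fun z l' _ => ?_⟩
  rcases List.eq_nil_or_concat l' with rfl | ⟨l, b, rfl⟩
  · exact (one_le_size (U z)).trans (hS z)
  · rw [List.concat_eq_append, List.foldl_append]
    exact (size_le_of_sublist (List.filter_sublist)).trans (hS z)

/-- The algorithm: saturate, and look for a pair of an accepting and a nonaccepting state. The
arguments are the sections of the input and a list of assignments. -/
def distinguishes (A T R : List Token) (τs : List Assignment) : Bool :=
  (saturate (table T) (τs.map fun τ => (τ, ruleValues (table T) τ R))
    ((stateNames A).flatMap fun p => (stateNames A).map fun q => (p, q))).any fun e =>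
      !decide ((acceptNames A).any (fun q => decide (q = e.1)) =
        (acceptNames A).any (fun q => decide (q = e.2)))

@[fun_prop]
theorem FP.distinguishes {Z : Type} [Enc Z] {A T R : Z → List Token} {τs : Z → List Assignment}
    (hA : FP A) (hT : FP T) (hR : FP R) (hτs : FP τs) :
    FP fun z => distinguishes (A z) (T z) (R z) (τs z) := by
  unfold TreeRewriting.distinguishes
  fun_prop

/-- The section of an input with number `k`: `0` is the signature, `1` the states, `2` the
transitions, and `3` the rules. -/
def inputSection (k : ℕ) (w : List Letter) : List Token :=
  (List.tail^[k] (sections (tokens w))).headD []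

@[fun_prop]
theorem FP.inputSection {Z : Type} [Enc Z] (k : ℕ) {w : Z → List Letter} (hw : FP w) :
    FP fun z => inputSection k (w z) := by
  refine FP.headD ?_ (FP.const _)
  induction k with
  | zero => exact FP.sections (FP.tokens hw)
  | succ k ih =>
    simp only [Function.iterate_succ_apply']
    exact FP.listTail ih

/-! ### Assignments -/

/-- All assignments of states to the variables with numbers less than `N`. -/
def assignments : ℕ → List Name → List Assignment
  | 0, _ => [[]]
  | N + 1, Q => (assignments N Q).flatMap fun τ => Q.map fun q => (N.bits, q) :: τ

@[fun_prop]
theorem FP.assignments {Z : Type} [Enc Z] (N : ℕ) {Q : Z → List Name} (hQ : FP Q) :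
    FP fun z => assignments N (Q z) := by
  induction N with
  | zero => exact FP.const _
  | succ N ih =>
    simp only [TreeRewriting.assignments]
    fun_prop

/-- A step in reading a certificate, which consists of blocks of two bits. The state contains the
bits of the block read so far, those of the current number in reverse order, the last variable read,
and an assignment. -/
def certificateStep (s : Name × Name × Name × Assignment) (b : Bool) :
    Name × Name × Name × Assignment :=
  bif s.1.isEmpty then ([b], s.2) else
  bif s.1.headD false then ([], b :: s.2.1, s.2.2) else
  bif b then ([], [], [], (s.2.2.1, s.2.1) :: s.2.2.2) else ([], [], s.2.1, s.2.2.2)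

/-- The assignment described by a certificate. -/
def readCertificate (w : List Bool) : Assignment :=
  (w.foldl certificateStep ([], [], [], [])).2.2.2

@[fun_prop]
theorem FP.readCertificate {Z : Type} [Enc Z] {w : Z → List Bool} (hw : FP w) :
    FP fun z => readCertificate (w z) := by
  refine FP.comp (f := TreeRewriting.readCertificate) (FP.snd (FP.snd (FP.snd ?_))) hw
  refine FP.foldl_of_size_le (h := fun _ => certificateStep) (by unfold certificateStep; fun_prop)
    (FP.const _) FP.id ⟨10, fun w s b _ => ?_⟩
  obtain ⟨u, x, y, τ⟩ := s
  have h₁ := size_bool_le b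
  unfold certificateStep
  rcases u with _ | ⟨_ | _, u⟩ <;> cases b <;> simp [size_prod, size_true, size_false] <;> omega

/-- Given the word of an input, decide whether inconsistency is witnessed by an assignment to the
first `N` variables. -/
def inconsistentBounded (N : ℕ) (w : List Letter) : Bool :=
  distinguishes (inputSection 1 w) (inputSection 2 w) (inputSection 3 w)
    (assignments N (stateNames (inputSection 1 w)))

theorem fp_inconsistentBounded (N : ℕ) : FP (inconsistentBounded N) := by
  unfold inconsistentBounded
  fun_prop

/-- Given the word of an input and a certificate, decide whether inconsistency is witnessed by the
assignment that the certificate describes. -/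
def verify (w : List (Letter ⊕ Bool)) : Bool :=
  let u := (w.filter fun a => !a.isRight).map asLetter
  distinguishes (inputSection 1 u) (inputSection 2 u) (inputSection 3 u)
    [readCertificate ((w.filter Sum.isRight).map fun a => bitValue (asLetter a))]

theorem fp_verify : FP verify := by
  unfold verify
  fun_prop

end TreeRewriting

namespace TreeRewriting

/-! ### Binary notation -/

theorem bits_injective {m n : ℕ} (h : m.bits = n.bits) : m = n :=
  Nat.digits.injective 2 (by rw [Nat.digits_two_eq_bits, Nat.digits_two_eq_bits, h])

theorem bits_ne_junk (n : ℕ) : n.bits ≠ junk := by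
  intro h
  have h₁ := Nat.digits_two_eq_bits n
  rw [h] at h₁
  have h₂ := Nat.ofDigits_digits 2 n
  rw [h₁] at h₂
  simp [junk] at h₁ h₂
  subst h₂
  simp at h₁

theorem fin_bits_injective {n : ℕ} {p q : Fin n} (h : (p : ℕ).bits = (q : ℕ).bits) : p = q :=
  Fin.ext (bits_injective h)

/-! ### The tokens of an input -/

/-- The word `u` consists of the tokens `ts`. -/
def Tokenizes (u : List Letter) (ts : List Token) : Prop :=
  ∀ s, u.foldr tokenStep ([], s) = ([], ts ++ s)

theorem Tokenizes.append {u u' : List Letter} {ts ts' : List Token} (h : Tokenizes u ts)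
    (h' : Tokenizes u' ts') : Tokenizes (u ++ u') (ts ++ ts') := fun s => by
  rw [List.foldr_append, h', h, List.append_assoc]

theorem Tokenizes.nil : Tokenizes [] [] := fun _ => rfl

theorem Tokenizes.flatMap {ι : Type} {u : ι → List Letter} {ts : ι → List Token}
    (h : ∀ i, Tokenizes (u i) (ts i)) (L : List ι) : Tokenizes (L.flatMap u) (L.flatMap ts) := by
  induction L with
  | nil => exact .nil
  | cons i L ih => exact (h i).append ih

theorem encodeFamily_eq {n : ℕ} (w : Fin n → List Letter) :
    encodeFamily w = (List.finRange n).flatMap w := by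
  rw [encodeFamily, List.ofFn_eq_map, List.flatMap_def]

theorem Tokenizes.family {n : ℕ} {u : Fin n → List Letter} {ts : Fin n → List Token}
    (h : ∀ i, Tokenizes (u i) (ts i)) :
    Tokenizes (encodeFamily u) ((List.finRange n).flatMap ts) := by
  rw [encodeFamily_eq]
  exact Tokenizes.flatMap h _

theorem Tokenizes.number {a : Letter} (ha : isBit a = false) (n : ℕ) :
    Tokenizes (a :: encodeNumber n) [(a, n.bits)] := fun s => by
  have h : ∀ u : List Bool, (u.map Letter.bit).foldr tokenStep ([], s) = (u, s) := by
    intro u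
    induction u with
    | nil => rfl
    | cons b u ih => rw [List.map_cons, List.foldr_cons, ih]; rfl
  rw [List.foldr_cons, encodeNumber, h, tokenStep, ha]
  rfl

theorem Tokenizes.letter {a : Letter} (ha : isBit a = false) :
    Tokenizes [a] [(a, [])] := fun s => by
  rw [List.foldr_cons, List.foldr_nil, tokenStep, ha]
  rfl

variable {S : Signature} {n : ℕ}

/-- The tokens of a state, with the mark of accepting states. -/
def stateTokens (A : DFTA S (Fin n)) (q : Fin n) : List Token :=
  (.state, (q : ℕ).bits) :: if A.accepting q then [(.accept, [])] else []

/-- The tokens of a transition: they split the word `encodeTransition`. -/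
def transitionTokens (A : DFTA S (Fin n)) (f : Fin S.numSymbols) (q : Fin (S.arity f) → Fin n) :
    List Token :=
  (.sym, (f : ℕ).bits) :: ((List.finRange (S.arity f)).flatMap
    fun i => [((.state, (q i : ℕ).bits) : Token)]) ++
    [(.arrow, []), (.state, (A.delta f q : ℕ).bits), (.close, [])]

/-- The tokens of a term: they split the word `encodeTerm`. -/
def termTokens : Term S ℕ → List Token
  | .var x => [(.var, x.bits)]
  | .app f ts => (.sym, (f : ℕ).bits) ::
      ((List.finRange (S.arity f)).flatMap fun i => termTokens (ts i)) ++ [(.close, [])]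

/-- The tokens of a rule: they split the word `encodeRule`. -/
def ruleTokens (ρ : Rule S) : List Token :=
  termTokens ρ.1 ++ (.arrow, []) :: termTokens ρ.2 ++ [(.close, [])]

/-- The tokens of the transition table, in the order of `encodeTransitions`. -/
def tableTokens (A : DFTA S (Fin n)) : List Token :=
  (List.finRange S.numSymbols).flatMap fun f => (List.finRange (n ^ S.arity f)).flatMap fun j =>
    transitionTokens A f (finFunctionFinEquiv.symm j)

/-- The tokens of a signature. They are not used by the algorithm, which takes the arities from the
transition table. -/
def signatureTokens (S : Signature) : List Token :=
  (List.finRange S.numSymbols).flatMap fun f : Fin S.numSymbols =>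
    [(.sym, (f : ℕ).bits), (.arity, (S.arity f).bits)]

theorem tokenizes_signature : Tokenizes (encodeSignature S) (signatureTokens S) :=
  .family fun f => (Tokenizes.number (a := .sym) rfl (f : ℕ)).append
    (Tokenizes.number (a := .arity) rfl (S.arity f))

theorem tokenizes_states (A : DFTA S (Fin n)) :
    Tokenizes (encodeStates A) ((List.finRange n).flatMap (stateTokens A)) := by
  refine .family fun q => ?_
  refine (Tokenizes.number (a := .state) rfl q).append
    (ts' := if A.accepting q then [(.accept, [])] else []) ?_
  split_ifs
  · exact .letter rfl
  · exact .nil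

theorem tokenizes_transitions (A : DFTA S (Fin n)) :
    Tokenizes (encodeTransitions A) (tableTokens A) := by
  refine .family fun f => .family fun j => ?_
  have h := (((Tokenizes.number (a := .sym) rfl (f : ℕ)).append (Tokenizes.family fun i =>
    Tokenizes.number (a := .state) rfl (finFunctionFinEquiv.symm j i : ℕ))).append
    ((Tokenizes.letter (a := .arrow) rfl).append (Tokenizes.number (a := .state) rfl
      (A.delta f (finFunctionFinEquiv.symm j) : ℕ)))).append (Tokenizes.letter (a := .close) rfl)
  simpa [encodeTransition, encodeSymbol, encodeState, transitionTokens] using h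

theorem tokenizes_term (u : Term S ℕ) : Tokenizes (encodeTerm u) (termTokens u) := by
  induction u with
  | var x => exact .number rfl x
  | app f ts ih =>
    exact ((Tokenizes.number (a := .sym) rfl (f : ℕ)).append (.family ih)).append
      (.letter (a := .close) rfl)

theorem tokenizes_rule (ρ : Rule S) : Tokenizes (encodeRule ρ) (ruleTokens ρ) := by
  have h := ((tokenizes_term ρ.1).append ((Tokenizes.letter (a := .arrow) rfl).append
    (tokenizes_term ρ.2))).append (.letter (a := .close) rfl)
  simpa [encodeRule, ruleTokens] using h

theorem tokens_encode (x : Input) : tokens x.encode =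
    signatureTokens x.sig ++ (.sep, []) ::
      ((List.finRange x.numStates).flatMap (stateTokens x.aut) ++ (.sep, []) ::
        (tableTokens x.aut ++ (.sep, []) :: x.trs.flatMap ruleTokens)) := by
  have hs : Tokenizes [Letter.sep] [(.sep, [])] := .letter rfl
  have h := (tokenizes_signature (S := x.sig)).append (hs.append ((tokenizes_states x.aut).append
    (hs.append ((tokenizes_transitions x.aut).append
      (hs.append (Tokenizes.flatMap tokenizes_rule x.trs))))))
  have h' := h []
  rw [tokens, Input.encode]
  simp only [List.flatMap_def, List.nil_append, List.append_nil, List.append_assoc,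
    List.cons_append] at h' ⊢
  rw [h']

theorem foldr_sectionStep {l : List Token} (hl : ∀ t ∈ l, t.1 ≠ .sep) (m : List Token)
    (r : List (List Token)) : l.foldr sectionStep (m, r) = (l ++ m, r) := by
  induction l with
  | nil => rfl
  | cons t l ih =>
    rw [List.foldr_cons, ih fun t ht => hl t (by simp [ht]), sectionStep,
      decide_eq_false (hl t (by simp))]
    rfl

theorem sections_sep {l : List Token} (hl : ∀ t ∈ l, t.1 ≠ .sep) (l' : List Token) :
    sections (l ++ (.sep, []) :: l') = l :: sections l' := by
  simp only [sections, List.foldr_append, List.foldr_cons]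
  rw [sectionStep, decide_eq_true rfl, cond_true, foldr_sectionStep hl]
  simp

theorem sections_of_forall_ne {l : List Token} (hl : ∀ t ∈ l, t.1 ≠ .sep) : sections l = [l] := by
  simp [sections, foldr_sectionStep hl]

theorem termTokens_ne_sep (u : Term S ℕ) : ∀ t ∈ termTokens u, t.1 ≠ .sep := by
  induction u with
  | var x => simp [termTokens]
  | app f ts ih =>
    intro t ht
    simp only [termTokens, List.cons_append, List.mem_cons, List.mem_append, List.mem_flatMap,
      List.mem_finRange, true_and, List.not_mem_nil, or_false] at ht
    rcases ht with rfl | ⟨i, hi⟩ | rfl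
    · simp
    · exact ih i t hi
    · simp

theorem sections_encode (x : Input) : sections (tokens x.encode) = [signatureTokens x.sig,
    (List.finRange x.numStates).flatMap (stateTokens x.aut), tableTokens x.aut,
    x.trs.flatMap ruleTokens] := by
  rw [tokens_encode, sections_sep, sections_sep, sections_sep, sections_of_forall_ne]
  · intro t ht
    obtain ⟨ρ, -, ht⟩ := List.mem_flatMap.1 ht
    simp only [ruleTokens, List.append_assoc, List.cons_append, List.mem_append, List.mem_cons,
      List.not_mem_nil, or_false] at ht
    rcases ht with ht | rfl | ht | rfl
    · exact termTokens_ne_sep _ t ht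
    · simp
    · exact termTokens_ne_sep _ t ht
    · simp
  · intro t ht
    simp only [tableTokens, transitionTokens, List.mem_flatMap, List.mem_append, List.mem_cons,
      List.not_mem_nil, or_false] at ht
    obtain ⟨f, -, j, -, (rfl | ⟨i, -, rfl⟩) | rfl | rfl | rfl⟩ := ht <;> simp
  · intro t ht
    simp only [stateTokens, List.mem_flatMap, List.mem_cons] at ht
    obtain ⟨q, -, rfl | ht⟩ := ht
    · simp
    · split_ifs at ht <;> simp_all
  · intro t ht
    simp only [signatureTokens, List.mem_flatMap, List.mem_cons, List.not_mem_nil, or_false] at ht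
    obtain ⟨q, -, rfl | rfl⟩ := ht <;> simp

theorem inputSection_one (x : Input) : inputSection 1 x.encode =
    (List.finRange x.numStates).flatMap (stateTokens x.aut) := by
  rw [inputSection, sections_encode]; rfl

theorem inputSection_two (x : Input) : inputSection 2 x.encode = tableTokens x.aut := by
  rw [inputSection, sections_encode]; rfl

theorem inputSection_three (x : Input) : inputSection 3 x.encode = x.trs.flatMap ruleTokens := by
  rw [inputSection, sections_encode]; rfl

/-! ### The automaton is read correctly -/

theorem stateNames_stateTokens (A : DFTA S (Fin n)) :
    stateNames ((List.finRange n).flatMap (stateTokens A)) =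
      (List.finRange n).map fun q : Fin n => (q : ℕ).bits := by
  induction List.finRange n with
  | nil => rfl
  | cons q L ih =>
    simp only [stateNames] at ih ⊢
    rw [List.flatMap_cons, List.filter_append, List.map_append, ih, stateTokens]
    split_ifs <;> simp

theorem mem_acceptNames (A : DFTA S (Fin n)) (q : Fin n) :
    (q : ℕ).bits ∈ acceptNames ((List.finRange n).flatMap (stateTokens A)) ↔
      A.accepting q = true := by
  have key : ∀ L : List (Fin n), (L.flatMap (stateTokens A)).foldr acceptStep (false, []) =
      (false, (L.filter A.accepting).map fun q : Fin n => (q : ℕ).bits) := by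
    intro L
    induction L with
    | nil => rfl
    | cons q L ih =>
      rw [List.flatMap_cons, List.foldr_append, ih, stateTokens]
      cases h : A.accepting q <;> simp [acceptStep, h]
  rw [acceptNames, key]
  simp only [List.mem_map, List.mem_filter, List.mem_finRange, true_and]
  constructor
  · rintro ⟨p, hp, h⟩
    rwa [← fin_bits_injective h]
  · exact fun h => ⟨q, h, rfl⟩

/-- A transition in the form in which it is read. -/
def transitionOf (A : DFTA S (Fin n)) (f : Fin S.numSymbols) (q : Fin (S.arity f) → Fin n) :
    Transition :=
  ((f : ℕ).bits, (A.delta f q : ℕ).bits ::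
    ((List.finRange (S.arity f)).map fun i => (q i : ℕ).bits).reverse)

theorem foldl_transitionTokens (A : DFTA S (Fin n)) (f : Fin S.numSymbols)
    (q : Fin (S.arity f) → Fin n) (out : List Transition) :
    (transitionTokens A f q).foldl tableStep (([], []), out) =
      (([], []), transitionOf A f q :: out) := by
  have key : ∀ (L : List (Fin (S.arity f))) (g : Name) (qs : List Name),
      (L.flatMap fun i => [((.state, (q i : ℕ).bits) : Token)]).foldl tableStep ((g, qs), out) =
        ((g, (L.map fun i => (q i : ℕ).bits).reverse ++ qs), out) := by
    intro L
    induction L with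
    | nil => simp
    | cons i L ih =>
      intro g qs
      rw [List.flatMap_cons, List.foldl_append]
      simp [tableStep, ih]
  rw [transitionTokens, List.foldl_append, List.foldl_cons, tableStep]
  simp [key, tableStep, transitionOf]

/-- The table consists of the transitions of the automaton. It is listed in reverse order. -/
theorem mem_table (A : DFTA S (Fin n)) (t : Transition) :
    t ∈ table (tableTokens A) ↔ ∃ f q, t = transitionOf A f q := by
  have h₁ : ∀ {ι : Type} (g : ι → List Token) (P : ι → Transition → Prop)
      (_ : ∀ i out, ∃ out', (g i).foldl tableStep (([], []), out) = (([], []), out') ∧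
        ∀ t, t ∈ out' ↔ P i t ∨ t ∈ out) (L : List ι) (out : List Transition),
      ∃ out', (L.flatMap g).foldl tableStep (([], []), out) = (([], []), out') ∧
        ∀ t, t ∈ out' ↔ (∃ i ∈ L, P i t) ∨ t ∈ out := by
    intro ι g P hg L
    induction L with
    | nil => intro out; exact ⟨out, rfl, by simp⟩
    | cons i L ih =>
      intro out
      obtain ⟨o₁, e₁, h₁⟩ := hg i out
      obtain ⟨o₂, e₂, h₂⟩ := ih o₁
      refine ⟨o₂, by rw [List.flatMap_cons, List.foldl_append, e₁, e₂], fun t => ?_⟩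
      rw [h₂, h₁]
      simp only [List.mem_cons, exists_eq_or_imp]
      rw [or_left_comm, or_assoc]
  obtain ⟨out, e, h⟩ := h₁ (fun f : Fin S.numSymbols => (List.finRange (n ^ S.arity f)).flatMap
      fun j => transitionTokens A f (finFunctionFinEquiv.symm j))
    (fun f t => ∃ j ∈ List.finRange (n ^ S.arity f),
      t = transitionOf A f (finFunctionFinEquiv.symm j))
    (fun f => h₁ _ (fun j t => t = transitionOf A f (finFunctionFinEquiv.symm j))
      (fun j out => ⟨_, foldl_transitionTokens A f _ out, fun t => by simp⟩) _)
    (List.finRange S.numSymbols) []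
  rw [table, tableTokens, e]
  simp only [h, List.mem_finRange, true_and, List.not_mem_nil, or_false]
  constructor
  · rintro ⟨f, j, rfl⟩
    exact ⟨f, _, rfl⟩
  · rintro ⟨f, q, rfl⟩
    exact ⟨f, finFunctionFinEquiv q, by simp⟩

/-! ### Terms are evaluated correctly -/

/-- The value of a term as computed by the algorithm. -/
def evalName (T : List Transition) (τ : Assignment) : Term S ℕ → Name
  | .var x => lookupVariable τ x.bits
  | .app f ts => lookupTransition T (f : ℕ).bits
      ((List.finRange (S.arity f)).map fun i => evalName T τ (ts i)).reverse

/-- The term `u` has the value `q` under a partial assignment of states to the variables, given as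
a relation. -/
def Evaluates (A : DFTA S (Fin n)) (v : ℕ → Fin n → Prop) : Term S ℕ → Fin n → Prop
  | .var x, q => v x q
  | .app f ts, q => ∃ qs, (∀ i, Evaluates A v (ts i) (qs i)) ∧ A.delta f qs = q

/-- Reading a term pushes its value on the current frame and changes nothing else. -/
theorem foldl_termTokens (T : List Transition) (τ : Assignment) (u : Term S ℕ) (f : Name)
    (qs : List Name) (st : List Transition) (out : List (Name × Name)) :
    (termTokens u).foldl (evalStep T τ) ((f, qs), st, out) =
      ((f, evalName T τ u :: qs), st, out) := by
  induction u generalizing f qs st out with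
  | var x => simp [termTokens, evalStep, evalName]
  | app g ts ih =>
    have key : ∀ (L : List (Fin (S.arity g))) (h : Name) (qs : List Name) (st : List Transition),
        (L.flatMap fun i => termTokens (ts i)).foldl (evalStep T τ) ((h, qs), st, out) =
          ((h, (L.map fun i => evalName T τ (ts i)).reverse ++ qs), st, out) := by
      intro L
      induction L with
      | nil => simp
      | cons i L ihL =>
        intro h qs st
        rw [List.flatMap_cons, List.foldl_append, ih, ihL]
        simp
    rw [termTokens, List.foldl_append, List.foldl_cons]
    simp [evalStep, key, evalName]

theorem ruleValues_ruleTokens (T : List Transition) (τ : Assignment) (R : TRS S)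
    (e : Name × Name) : e ∈ ruleValues T τ (R.flatMap ruleTokens) ↔
      ∃ ρ ∈ R, e = (evalName T τ ρ.1, evalName T τ ρ.2) := by
  have hρ : ∀ (ρ : Rule S) (out : List (Name × Name)),
      (ruleTokens ρ).foldl (evalStep T τ) (([], []), [], out) =
        (([], []), [], (evalName T τ ρ.1, evalName T τ ρ.2) :: out) := by
    intro ρ out
    rw [ruleTokens, List.foldl_append, List.foldl_append, foldl_termTokens, List.foldl_cons]
    exact congrArg (List.foldl (evalStep T τ) · [((.close, []) : Token)])
      (foldl_termTokens T τ ρ.2 [] [evalName T τ ρ.1] [] out)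
  have key : ∀ (R : TRS S) (out : List (Name × Name)),
      (R.flatMap ruleTokens).foldl (evalStep T τ) (([], []), [], out) =
        (([], []), [], (R.map fun ρ => (evalName T τ ρ.1, evalName T τ ρ.2)).reverse ++ out) := by
    intro R
    induction R with
    | nil => simp
    | cons ρ R ih =>
      intro out
      rw [List.flatMap_cons, List.foldl_append, hρ, ih]
      simp
  rw [ruleValues, key]
  simp [eq_comm]

theorem headD_map_filter {α β : Type} {l : List α} {p : α → Bool} {g : α → β} {d b : β}
    (hb : b ≠ d) : ((l.filter p).map g).headD d = b → ∃ a ∈ l, p a = true ∧ g a = b := by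
  cases h : l.filter p with
  | nil => exact fun e => (hb e.symm).elim
  | cons a l' =>
    intro e
    have ha : a ∈ l.filter p := by rw [h]; simp
    exact ⟨a, (List.mem_filter.1 ha).1, (List.mem_filter.1 ha).2, by simpa using e⟩

theorem headD_map_filter_of_mem {α β : Type} {l : List α} {p : α → Bool} {g : α → β} {d b : β}
    {a : α} (ha : a ∈ l) (hpa : p a = true) (h : ∀ a ∈ l, p a = true → g a = b) :
    ((l.filter p).map g).headD d = b := by
  cases h' : l.filter p with
  | nil => exact absurd (List.mem_filter.2 ⟨ha, hpa⟩) (by rw [h']; simp)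
  | cons a' l' =>
    have ha' : a' ∈ l.filter p := by rw [h']; simp
    simpa using h a' (List.mem_filter.1 ha').1 (List.mem_filter.1 ha').2

/-- Looking up a transition succeeds precisely if all arguments are states: `junk` is not among the
names of the states. -/
theorem lookupTransition_eq_bits (A : DFTA S (Fin n)) (f : Fin S.numSymbols)
    (qs : Fin (S.arity f) → Name) (q : Fin n) :
    lookupTransition (table (tableTokens A)) (f : ℕ).bits
      ((List.finRange (S.arity f)).map qs).reverse = (q : ℕ).bits ↔
      ∃ ps, (∀ i, qs i = (ps i : ℕ).bits) ∧ A.delta f ps = q := by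
  have key : ∀ t ∈ table (tableTokens A), (decide (t.1 = (f : ℕ).bits) &&
      decide (t.2.tail = ((List.finRange (S.arity f)).map qs).reverse)) = true →
      ∃ ps, (∀ i, qs i = (ps i : ℕ).bits) ∧ t.2.headD junk = (A.delta f ps : ℕ).bits := by
    intro t ht h
    obtain ⟨g, ps, rfl⟩ := (mem_table A t).1 ht
    rw [Bool.and_eq_true, decide_eq_true_eq, decide_eq_true_eq] at h
    obtain rfl := fin_bits_injective h.1
    have h₂ := List.reverse_inj.1 h.2
    refine ⟨ps, fun i => ?_, rfl⟩
    exact (List.map_inj_left.1 h₂ i (List.mem_finRange i)).symm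
  constructor
  · intro h
    obtain ⟨t, ht, h₁, h₂⟩ := headD_map_filter (bits_ne_junk _) h
    obtain ⟨ps, h₃, h₄⟩ := key t ht h₁
    exact ⟨ps, h₃, fin_bits_injective (h₄.symm.trans h₂)⟩
  · rintro ⟨ps, h, rfl⟩
    refine headD_map_filter_of_mem (a := transitionOf A f ps) ((mem_table A _).2 ⟨f, ps, rfl⟩) ?_ ?_
    · simp [transitionOf, h]
    · intro t ht h'
      obtain ⟨ps', h₃, h₄⟩ := key t ht h'
      have : ps' = ps := funext fun i => fin_bits_injective ((h₃ i).symm.trans (h i))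
      rw [h₄, this]

theorem evalName_eq_bits (A : DFTA S (Fin n)) (τ : Assignment) (u : Term S ℕ) (q : Fin n) :
    evalName (table (tableTokens A)) τ u = (q : ℕ).bits ↔
      Evaluates A (fun x q => lookupVariable τ x.bits = (q : ℕ).bits) u q := by
  induction u generalizing q with
  | var x => rfl
  | app f ts ih =>
    rw [evalName, lookupTransition_eq_bits, Evaluates]
    simp only [ih]

end TreeRewriting

namespace TreeRewriting

variable {S : Signature} {n : ℕ}

/-! ### Pairs of states before and after rewriting -/

/-- The pairs of states that are reached on trees `s` and `t` such that `s` rewrites to `t` by a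
parallel application of rules, when the states of the subtrees substituted for the variables are
given by assignments from `𝒯`. -/
inductive Derives (A : DFTA S (Fin n)) (R : TRS S) (𝒯 : Set Assignment) : Fin n → Fin n → Prop
  | app (f : Fin S.numSymbols) (ps qs : Fin (S.arity f) → Fin n)
      (h : ∀ i, Derives A R 𝒯 (ps i) (qs i)) : Derives A R 𝒯 (A.delta f ps) (A.delta f qs)
  | rule (τ : Assignment) (hτ : τ ∈ 𝒯) (c : Name × Name → Fin n)
      (hc : ∀ e ∈ τ, e.2 = (c e : ℕ).bits) (hd : ∀ e ∈ τ, Derives A R 𝒯 (c e) (c e))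
      (ρ : Rule S) (hρ : ρ ∈ R) (p q : Fin n)
      (hp : Evaluates A (fun x q => lookupVariable τ x.bits = (q : ℕ).bits) ρ.1 p)
      (hq : Evaluates A (fun x q => lookupVariable τ x.bits = (q : ℕ).bits) ρ.2 q) :
      Derives A R 𝒯 p q

/-! ### Saturation computes the least fixed point -/

/-- The result of the iteration is closed under `F`: an increasing sequence of subsets of `U` is
stationary after at most as many steps as `U` has elements. -/
theorem saturation_closed {α : Type} (U : List α) (F : List α → α → Bool)
    (hF : ∀ P P', P ⊆ P' → ∀ e, F P e = true → F P' e = true) {e : α} (he : e ∈ U)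
    (h : F (U.foldl (fun P _ => U.filter (F P)) []) e = true) :
    e ∈ U.foldl (fun P _ => U.filter (F P)) [] := by
  classical
  set G : List α → List α := fun P => U.filter (F P) with hG
  have hmono : ∀ {P P'}, P ⊆ P' → G P ⊆ G P' := fun hP e he => by
    rw [hG, List.mem_filter] at he ⊢
    exact ⟨he.1, hF _ _ hP e he.2⟩
  have hfold : ∀ (l : List α) (P : List α), l.foldl (fun P _ => G P) P = G^[l.length] P := by
    intro l
    induction l with
    | nil => intro P; rfl
    | cons a l ih => intro P; rw [List.foldl_cons, ih]; rfl
  change F (U.foldl (fun P _ => G P) []) e = true at h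
  change e ∈ U.foldl (fun P _ => G P) []
  rw [hfold] at h ⊢
  have hstep : ∀ k, G^[k] [] ⊆ G^[k + 1] [] := by
    intro k
    induction k with
    | zero => exact List.nil_subset _
    | succ k ih => rw [Function.iterate_succ_apply', Function.iterate_succ_apply' G (k + 1)]
                   exact hmono ih
  have hsub : ∀ k, G^[k] [] ⊆ U := by
    intro k
    cases k with
    | zero => exact List.nil_subset _
    | succ k =>
      rw [Function.iterate_succ_apply']
      exact fun e he => (List.mem_filter.1 he).1
  -- As long as the iteration has not become stationary, each round adds an element.
  have hcard : ∀ k, k ≤ (G^[k] []).toFinset.card ∨ G^[k + 1] [] ⊆ G^[k] [] := by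
    intro k
    induction k with
    | zero => exact Or.inl (Nat.zero_le _)
    | succ k ih =>
      by_cases hs : G^[k + 1] [] ⊆ G^[k] []
      · right
        have h' := hmono hs
        rwa [← Function.iterate_succ_apply' G, ← Function.iterate_succ_apply' G] at h'
      · left
        have hk := ih.resolve_right hs
        refine Nat.lt_of_le_of_lt hk (Finset.card_lt_card ⟨?_, ?_⟩)
        · exact fun e he => List.mem_toFinset.2 (hstep k (List.mem_toFinset.1 he))
        · intro h'
          exact hs fun e he => List.mem_toFinset.1 (h' (List.mem_toFinset.2 he))
  have hG' : e ∈ G^[U.length + 1] [] := by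
    rw [Function.iterate_succ_apply']
    exact List.mem_filter.2 ⟨he, h⟩
  rcases hcard U.length with hc | hc
  · have h₁ : (G^[U.length] []).toFinset = U.toFinset :=
      Finset.eq_of_subset_of_card_le
        (fun e he => List.mem_toFinset.2 (hsub _ (List.mem_toFinset.1 he)))
        ((List.toFinset_card_le U).trans hc)
    rw [← List.mem_toFinset, h₁, List.mem_toFinset]
    exact he
  · exact hc hG'

theorem saturation_induction {α : Type} (U : List α) (F : List α → α → Bool) (X : α → Prop)
    (hX : ∀ P, (∀ e ∈ P, X e) → ∀ e ∈ U, F P e = true → X e) :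
    ∀ e ∈ U.foldl (fun P _ => U.filter (F P)) [], X e := by
  have key : ∀ (l P : List α), (∀ e ∈ P, X e) →
      ∀ e ∈ l.foldl (fun P _ => U.filter (F P)) P, X e := by
    intro l
    induction l with
    | nil => exact fun P hP => hP
    | cons a l ih =>
      intro P hP
      refine ih _ fun e he => ?_
      exact hX P hP e (List.mem_filter.1 he).1 (List.mem_filter.1 he).2
  exact key U [] (by simp)

theorem related_iff (P : List (Name × Name)) (p q : Name) :
    related P p q = true ↔ (p, q) ∈ P := by
  simp [related]

theorem zipAll_transitionOf (A : DFTA S (Fin n)) (P : List (Name × Name))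
    (f : Fin S.numSymbols) (ps qs : Fin (S.arity f) → Fin n) :
    zipAll (related P) (transitionOf A f ps).2.tail (transitionOf A f qs).2.tail = true ↔
      ∀ i, ((ps i : ℕ).bits, (qs i : ℕ).bits) ∈ P := by
  rw [zipAll_eq _ _ _ (by simp [transitionOf])]
  have e : ((transitionOf A f ps).2.tail.zip (transitionOf A f qs).2.tail) =
      ((List.finRange (S.arity f)).map fun i => ((ps i : ℕ).bits, (qs i : ℕ).bits)).reverse := by
    simp only [transitionOf, List.tail_cons]
    rw [← List.map_reverse, ← List.map_reverse, ← List.map_reverse, List.zip_map']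
  rw [e]
  simp [related_iff]

theorem derivable_mono (T : List Transition) (I : List (Assignment × List (Name × Name)))
    (hT : ∀ t ∈ T, ∀ t' ∈ T, t.1 = t'.1 → t.2.tail.length = t'.2.tail.length)
    {P P' : List (Name × Name)} (h : P ⊆ P') (e : Name × Name)
    (hd : derivable T I P e = true) : derivable T I P' e = true := by
  have hr : ∀ {p q}, related P p q = true → related P' p q = true := fun {p q} hpq => by
    rw [related_iff] at hpq ⊢
    exact h hpq
  simp only [derivable, Bool.or_eq_true, List.any_eq_true, Bool.and_eq_true, decide_eq_true_eq,
    List.all_eq_true] at hd ⊢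
  rcases hd with ⟨t, ht, t', ht', ⟨⟨h₁, h₂⟩, h₃⟩, h₄⟩ | ⟨i, hi, h₁, h₂⟩
  · refine Or.inl ⟨t, ht, t', ht', ⟨⟨h₁, h₂⟩, h₃⟩, ?_⟩
    rw [zipAll_eq _ _ _ (hT t ht t' ht' h₁), List.all_eq_true] at h₄ ⊢
    exact fun x hx => hr (h₄ x hx)
  · exact Or.inr ⟨i, hi, fun x hx => hr (h₁ x hx), h₂⟩

/-- Saturation computes the derivable pairs. -/
theorem mem_saturate (A : DFTA S (Fin n)) (R : TRS S) (τs : List Assignment) (e : Name × Name) :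
    e ∈ saturate (table (tableTokens A)) (τs.map fun τ =>
        (τ, ruleValues (table (tableTokens A)) τ (R.flatMap ruleTokens)))
      ((stateNames ((List.finRange n).flatMap (stateTokens A))).flatMap fun p =>
        (stateNames ((List.finRange n).flatMap (stateTokens A))).map fun q => (p, q)) ↔
      ∃ p q, Derives A R {τ | τ ∈ τs} p q ∧ e = ((p : ℕ).bits, (q : ℕ).bits) := by
  set T := table (tableTokens A) with hT
  set I := τs.map fun τ => (τ, ruleValues T τ (R.flatMap ruleTokens)) with hI
  set U := (stateNames ((List.finRange n).flatMap (stateTokens A))).flatMap fun p =>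
    (stateNames ((List.finRange n).flatMap (stateTokens A))).map fun q => (p, q) with hU
  have hmemU : ∀ e, e ∈ U ↔ ∃ p q : Fin n, e = ((p : ℕ).bits, (q : ℕ).bits) := by
    intro e
    rw [hU, stateNames_stateTokens]
    simp only [List.mem_flatMap, List.mem_map, List.mem_finRange, true_and]
    constructor
    · rintro ⟨_, ⟨p, rfl⟩, _, ⟨q, rfl⟩, rfl⟩
      exact ⟨p, q, rfl⟩
    · rintro ⟨p, q, rfl⟩
      exact ⟨_, ⟨p, rfl⟩, _, ⟨q, rfl⟩, rfl⟩
  constructor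
  · refine saturation_induction U (derivable T I)
      (fun e => ∃ p q, Derives A R {τ | τ ∈ τs} p q ∧ e = ((p : ℕ).bits, (q : ℕ).bits))
      (fun P hP e he h => ?_) e
    have hP' : ∀ p q : Fin n, ((p : ℕ).bits, (q : ℕ).bits) ∈ P →
        Derives A R {τ | τ ∈ τs} p q := by
      intro p q hpq
      obtain ⟨p', q', hd, h'⟩ := hP _ hpq
      rw [Prod.mk.injEq] at h'
      rwa [fin_bits_injective h'.1, fin_bits_injective h'.2]
    simp only [derivable, Bool.or_eq_true, List.any_eq_true, Bool.and_eq_true, decide_eq_true_eq,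
      List.all_eq_true] at h
    rcases h with ⟨t, ht, t', ht', ⟨⟨h₁, h₂⟩, h₃⟩, h₄⟩ | ⟨i, hi, h₁, h₂⟩
    · obtain ⟨f, ps, rfl⟩ := (mem_table A t).1 ht
      obtain ⟨g, qs, rfl⟩ := (mem_table A t').1 ht'
      obtain rfl := fin_bits_injective h₁
      rw [zipAll_transitionOf] at h₄
      exact ⟨_, _, .app f ps qs fun i => hP' _ _ (h₄ i), Prod.ext h₂.symm h₃.symm⟩
    · obtain ⟨τ, hτ, rfl⟩ := List.mem_map.1 hi
      obtain ⟨p, q, rfl⟩ := (hmemU e).1 he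
      rw [related_iff, ruleValues_ruleTokens] at h₂
      obtain ⟨ρ, hρ, h₃⟩ := h₂
      rw [Prod.mk.injEq] at h₃
      have h₅ : ∀ x ∈ τ, ∃ c : Fin n, x.2 = (c : ℕ).bits ∧ Derives A R {τ | τ ∈ τs} c c := by
        intro x hx
        have := h₁ x hx
        rw [related_iff] at this
        obtain ⟨c, c', hd, h'⟩ := hP _ this
        rw [Prod.mk.injEq] at h'
        have := fin_bits_injective (h'.1.symm.trans h'.2)
        exact ⟨c, h'.1, by rwa [← this] at hd⟩
      have : Nonempty (Fin n) := ⟨p⟩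
      choose! c hc using h₅
      exact ⟨p, q, .rule τ hτ c (fun x hx => (hc x hx).1) (fun x hx => (hc x hx).2) ρ hρ p q
        ((evalName_eq_bits A τ _ _).1 h₃.1.symm) ((evalName_eq_bits A τ _ _).1 h₃.2.symm), rfl⟩
  · rintro ⟨p, q, hd, rfl⟩
    have hclosed := fun {e} => saturation_closed U (derivable T I) (fun P P' h e he =>
      derivable_mono T I (fun t ht t' ht' h => by
        obtain ⟨f, ps, rfl⟩ := (mem_table A t).1 ht
        obtain ⟨g, qs, rfl⟩ := (mem_table A t').1 ht'
        obtain rfl := fin_bits_injective h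
        simp [transitionOf]) h e he) (e := e)
    induction hd with
    | app f ps qs _ ih =>
      refine hclosed ((hmemU _).2 ⟨_, _, rfl⟩) ?_
      simp only [derivable, Bool.or_eq_true, List.any_eq_true, Bool.and_eq_true, decide_eq_true_eq]
      refine Or.inl ⟨_, (mem_table A _).2 ⟨f, ps, rfl⟩, _, (mem_table A _).2 ⟨f, qs, rfl⟩,
        ⟨⟨rfl, rfl⟩, rfl⟩, ?_⟩
      rw [zipAll_transitionOf]
      exact ih
    | rule τ hτ c hc _ ρ hρ p q hp hq ih =>
      refine hclosed ((hmemU _).2 ⟨_, _, rfl⟩) ?_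
      simp only [derivable, Bool.or_eq_true, List.any_eq_true, Bool.and_eq_true, decide_eq_true_eq,
        List.all_eq_true]
      refine Or.inr ⟨_, List.mem_map.2 ⟨τ, hτ, rfl⟩, fun x hx => ?_, ?_⟩
      · rw [related_iff, hc x hx]
        exact ih x hx
      · rw [related_iff, ruleValues_ruleTokens]
        refine ⟨ρ, hρ, ?_⟩
        rw [(evalName_eq_bits A τ _ _).2 hp, (evalName_eq_bits A τ _ _).2 hq]

/-- The algorithm finds out whether some derivable pair consists of an accepting and a nonaccepting
state. -/
theorem distinguishes_iff (A : DFTA S (Fin n)) (R : TRS S) (τs : List Assignment) :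
    distinguishes ((List.finRange n).flatMap (stateTokens A)) (tableTokens A)
      (R.flatMap ruleTokens) τs = true ↔
      ∃ p q, Derives A R {τ | τ ∈ τs} p q ∧ A.accepting p ≠ A.accepting q := by
  have ha : ∀ p : Fin n, ((acceptNames ((List.finRange n).flatMap (stateTokens A))).any
      fun q => decide (q = (p : ℕ).bits)) = A.accepting p := by
    intro p
    rw [Bool.eq_iff_iff, ← mem_acceptNames]
    simp
  rw [distinguishes, List.any_eq_true]
  simp only [mem_saturate]
  constructor
  · rintro ⟨_, ⟨p, q, hd, rfl⟩, h⟩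
    refine ⟨p, q, hd, ?_⟩
    simpa [ha] using h
  · rintro ⟨p, q, hd, h⟩
    exact ⟨_, ⟨p, q, hd, rfl⟩, by simpa [ha] using h⟩

/-! ### Soundness -/

/-- Rewriting the arguments one after the other. -/
theorem rewrites_app (R : TRS S) (f : Fin S.numSymbols) (ts us : Fin (S.arity f) → Term S ℕ)
    (h : ∀ i, Rewrites R (ts i) (us i)) : Rewrites R (.app f ts) (.app f us) := by
  have h₁ : ∀ (ts : Fin (S.arity f) → Term S ℕ) (i : Fin (S.arity f)) (t u : Term S ℕ),
      Rewrites R t u → Rewrites R (.app f (Function.update ts i t))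
        (.app f (Function.update ts i u)) := by
    intro ts i t u htu
    induction htu with
    | refl => exact .refl
    | @tail b c _ hbc ih =>
      refine ih.tail ?_
      have := Step.arg (R := R) f (Function.update ts i b) i c (by simpa using hbc)
      simpa using this
  classical
  have h₂ : ∀ s : Finset (Fin (S.arity f)),
      Rewrites R (.app f ts) (.app f (s.piecewise us ts)) := by
    intro s
    induction s using Finset.induction_on with
    | empty => rw [Finset.piecewise_empty]; exact .refl
    | @insert i s hi ih =>
      refine ih.trans ?_
      rw [Finset.piecewise_insert]
      have := h₁ (s.piecewise us ts) i (ts i) (us i) (h i)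
      rwa [show Function.update (s.piecewise us ts) i (ts i) = s.piecewise us ts by
        rw [Function.update_eq_self_iff, Finset.piecewise_eq_of_notMem _ _ _ hi]] at this
  have := h₂ Finset.univ
  rwa [Finset.piecewise_univ] at this

/-- Substituting trees that evaluate as prescribed into a term that has a value yields a tree with
this value. -/
theorem Evaluates.exists_tree {A : DFTA S (Fin n)} {v : ℕ → Fin n → Prop} {σ : ℕ → Term S ℕ}
    (hσ : ∀ x q, v x q → ∃ s : Tree S, σ x = s.toTerm ℕ ∧ A.run s = q) {u : Term S ℕ} {q : Fin n}
    (h : Evaluates A v u q) : ∃ s : Tree S, u.subst σ = s.toTerm ℕ ∧ A.run s = q := by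
  induction u generalizing q with
  | var x => exact hσ x q h
  | app f ts ih =>
    obtain ⟨qs, h, rfl⟩ := h
    choose s hs hs' using fun i => ih i (h i)
    refine ⟨.app f s, ?_, ?_⟩
    · simp only [Term.subst, Tree.toTerm] at hs ⊢
      congr 1
      funext i
      exact hs i
    · simp only [DFTA.run, hs']

/-- Derivable pairs of states are the values of two trees, the first of which rewrites to the
second. In particular the diagonal pairs that are required of an assignment say that its states are
reached on some trees, which can be substituted for the variables. -/
theorem Derives.exists_trees {A : DFTA S (Fin n)} {R : TRS S} {𝒯 : Set Assignment} {p q : Fin n}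
    (h : Derives A R 𝒯 p q) : ∃ s t : Tree S, Rewrites R (s.toTerm ℕ) (t.toTerm ℕ) ∧
      A.run s = p ∧ A.run t = q := by
  classical
  induction h with
  | app f ps qs _ ih =>
    choose s t hst hs ht using ih
    refine ⟨.app f s, .app f t, rewrites_app R f _ _ hst, ?_, ?_⟩
    · simp only [DFTA.run, hs]
    · simp only [DFTA.run, ht]
  | rule τ _ c hc _ ρ hρ p q hp hq ih =>
    -- Variables with a value are replaced by trees that evaluate to it.
    have hex : ∀ x : ℕ, ∃ u : Term S ℕ, ∀ q : Fin n, lookupVariable τ x.bits = (q : ℕ).bits →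
        ∃ s : Tree S, u = s.toTerm ℕ ∧ A.run s = q := by
      intro x
      by_cases hx : ∃ q : Fin n, lookupVariable τ x.bits = (q : ℕ).bits
      · obtain ⟨q, hq⟩ := hx
        obtain ⟨e, he, _, h₁⟩ := headD_map_filter (bits_ne_junk _) hq
        obtain ⟨s, _, _, hs, _⟩ := ih e he
        refine ⟨s.toTerm ℕ, fun q' hq' => ⟨s, rfl, ?_⟩⟩
        rw [hs]
        exact fin_bits_injective ((hc e he).symm.trans (h₁.trans (hq.symm.trans hq')))
      · exact ⟨.var x, fun q hq => (hx ⟨q, hq⟩).elim⟩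
    choose σ hσ using hex
    obtain ⟨s, hs, hs'⟩ := hp.exists_tree hσ
    obtain ⟨t, ht, ht'⟩ := hq.exists_tree hσ
    exact ⟨s, t, hs ▸ ht ▸ .single (.rule ρ.1 ρ.2 hρ σ), hs', ht'⟩

/-! ### Completeness -/

/-- The state of a term under a total assignment of states to the variables. -/
def termValue (A : DFTA S (Fin n)) (v : ℕ → Fin n) : Term S ℕ → Fin n
  | .var x => v x
  | .app f ts => A.delta f fun i => termValue A v (ts i)

theorem termValue_subst (A : DFTA S (Fin n)) (v : ℕ → Fin n) (σ : ℕ → Term S ℕ) (u : Term S ℕ) :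
    termValue A v (u.subst σ) = termValue A (fun x => termValue A v (σ x)) u := by
  induction u with
  | var x => rfl
  | app f ts ih => simp only [Term.subst, termValue, ih]

theorem termValue_toTerm (A : DFTA S (Fin n)) (v : ℕ → Fin n) (s : Tree S) :
    termValue A v (s.toTerm ℕ) = A.run s := by
  induction s with
  | var x => exact x.elim
  | app f ts ih =>
    simp only [Tree.toTerm, Term.subst, termValue, DFTA.run] at ih ⊢
    simp only [ih]

theorem evaluates_termValue (A : DFTA S (Fin n)) {r : ℕ → Fin n → Prop} {v : ℕ → Fin n}
    {u : Term S ℕ} (h : ∀ x ∈ u.vars, r x (v x)) : Evaluates A r u (termValue A v u) := by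
  induction u with
  | var x => exact h x rfl
  | app f ts ih =>
    exact ⟨_, fun i => ih i fun x hx => h x (Set.mem_iUnion.2 ⟨i, hx⟩), rfl⟩

/-- The finite assignment `τ` agrees with the assignment `v` of states to all variables, and
is defined on all variables that occur in the rules. -/
def Covers (R : TRS S) (v : ℕ → Fin n) (τ : Assignment) : Prop :=
  (∀ e ∈ τ, ∃ x : ℕ, e = (x.bits, (v x : ℕ).bits)) ∧
    ∀ ρ ∈ R, ∀ x ∈ ρ.1.vars ∪ ρ.2.vars, ((x.bits, (v x : ℕ).bits) : Name × Name) ∈ τ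

theorem Covers.lookupVariable {R : TRS S} {v : ℕ → Fin n} {τ : Assignment} (h : Covers R v τ)
    {ρ : Rule S} (hρ : ρ ∈ R) {x : ℕ} (hx : x ∈ ρ.1.vars ∪ ρ.2.vars) :
    lookupVariable τ x.bits = (v x : ℕ).bits := by
  refine headD_map_filter_of_mem (h.2 ρ hρ x hx) (by simp) fun e he he' => ?_
  obtain ⟨y, rfl⟩ := h.1 e he
  rw [bits_injective (of_decide_eq_true he')]

theorem Derives.refl {A : DFTA S (Fin n)} (R : TRS S) (𝒯 : Set Assignment) (s : Tree S) :
    Derives A R 𝒯 (A.run s) (A.run s) := by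
  induction s with
  | var x => exact x.elim
  | app f ts ih => exact .app f _ _ ih

theorem exists_tree_termValue (A : DFTA S (Fin n)) {v : ℕ → Fin n}
    (hv : ∀ x, ∃ s : Tree S, A.run s = v x) (u : Term S ℕ) :
    ∃ s : Tree S, A.run s = termValue A v u := by
  induction u with
  | var x => exact hv x
  | app f ts ih =>
    choose s hs using ih
    exact ⟨.app f s, by simp only [DFTA.run, termValue, hs]⟩

/-- A rewrite step is accounted for by a single assignment of reachable states to the variables. -/
theorem Step.derives {A : DFTA S (Fin n)} {R : TRS S} {v : ℕ → Fin n}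
    (hv : ∀ x, ∃ s : Tree S, A.run s = v x) {u u' : Term S ℕ} (h : Step R u u') :
    ∃ w : ℕ → Fin n, (∀ x, ∃ s : Tree S, A.run s = w x) ∧
      ∀ 𝒯 : Set Assignment, (∃ τ ∈ 𝒯, Covers R w τ) →
        Derives A R 𝒯 (termValue A v u) (termValue A v u') := by
  induction h with
  | rule l r h σ =>
    refine ⟨fun x => termValue A v (σ x), fun x => exists_tree_termValue A hv (σ x), ?_⟩
    rintro 𝒯 ⟨τ, hτ, hc⟩
    have h₁ : ∀ e ∈ τ, ∃ x, e = (Nat.bits x, Nat.bits (termValue A v (σ x))) := hc.1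
    choose! x hx using h₁
    refine .rule τ hτ (fun e => termValue A v (σ (x e))) (fun e he => by
      conv_lhs => rw [hx e he]) (fun e he => ?_) (l, r) h _ _ ?_ ?_
    · obtain ⟨s, hs⟩ := exists_tree_termValue A hv (σ (x e))
      rw [← hs]
      exact .refl R 𝒯 s
    · rw [termValue_subst]
      exact evaluates_termValue A fun x hx => hc.lookupVariable h (Or.inl hx)
    · rw [termValue_subst]
      exact evaluates_termValue A fun x hx => hc.lookupVariable h (Or.inr hx)
  | arg f ts i t _ ih =>
    obtain ⟨w, hw, h⟩ := ih
    refine ⟨w, hw, fun 𝒯 h𝒯 => .app f _ _ fun j => ?_⟩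
    by_cases hj : j = i
    · subst hj
      rw [Function.update_self]
      exact h 𝒯 h𝒯
    · rw [Function.update_of_ne hj]
      obtain ⟨s, hs⟩ := exists_tree_termValue A hv (ts j)
      rw [← hs]
      exact .refl R 𝒯 s

theorem not_consistent_of_derives {A : DFTA S (Fin n)} {R : TRS S} {𝒯 : Set Assignment}
    {p q : Fin n} (h : Derives A R 𝒯 p q) (hpq : A.accepting p ≠ A.accepting q) :
    ¬ Consistent R A.language := by
  obtain ⟨s, t, hst, rfl, rfl⟩ := h.exists_trees
  intro hc
  exact hpq (Bool.eq_iff_iff.2 (hc s t hst))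

/-- If consistency fails, then a single step changes acceptance, and this step uses a single rule
with a single assignment of states to its variables. The open terms that occur on the way from `s`
to `t` are evaluated with the state of `s` for all variables, which is reached on a tree. -/
theorem exists_derives_of_not_consistent {A : DFTA S (Fin n)} {R : TRS S}
    (h : ¬ Consistent R A.language) : ∃ w : ℕ → Fin n, (∀ x, ∃ s : Tree S, A.run s = w x) ∧
      ∀ 𝒯 : Set Assignment, (∃ τ ∈ 𝒯, Covers R w τ) →
        ∃ p q, Derives A R 𝒯 p q ∧ A.accepting p ≠ A.accepting q := by
  by_contra hno
  refine h fun s t hst => ?_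
  have hv : ∀ x : ℕ, ∃ s' : Tree S, A.run s' = (fun _ => A.run s) x := fun _ => ⟨s, rfl⟩
  have key : ∀ u, Rewrites R (s.toTerm ℕ) u →
      A.accepting (termValue A (fun _ => A.run s) u) = A.accepting (A.run s) := by
    intro u hu
    induction hu with
    | refl => rw [termValue_toTerm]
    | tail _ hstep ih =>
      rw [← ih]
      by_contra hne
      obtain ⟨w, hw, hd⟩ := hstep.derives hv
      exact hno ⟨w, hw, fun 𝒯 h𝒯 => ⟨_, _, hd 𝒯 h𝒯, fun e => hne e.symm⟩⟩
  have := key _ hst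
  rw [termValue_toTerm] at this
  change _ = true ↔ _ = true
  rw [this]

end TreeRewriting

namespace TreeRewriting

open scoped List

variable {S : Signature} {n : ℕ}

/-! ### Certificates -/

/-- The variables occurring in a term, with repetitions. -/
def varList : Term S ℕ → List ℕ
  | .var x => [x]
  | .app f ts => (List.finRange (S.arity f)).flatMap fun i => varList (ts i)

/-- The variables occurring in a rule, with repetitions. -/
def ruleVars (ρ : Rule S) : List ℕ := varList ρ.1 ++ varList ρ.2

theorem mem_varList {u : Term S ℕ} {x : ℕ} (h : x ∈ u.vars) : x ∈ varList u := by
  induction u with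
  | var y => exact List.mem_singleton.2 h
  | app f ts ih =>
    obtain ⟨i, hi⟩ := Set.mem_iUnion.1 h
    exact List.mem_flatMap.2 ⟨i, List.mem_finRange i, ih i hi⟩

theorem flatMap_sublist {ι α : Type} {g h : ι → List α} (hgh : ∀ i, g i <+ h i) (l : List ι) :
    l.flatMap g <+ l.flatMap h := by
  induction l with
  | nil => exact .refl _
  | cons i l ih =>
    rw [List.flatMap_cons, List.flatMap_cons]
    exact (hgh i).append ih

theorem varList_sublist (u : Term S ℕ) :
    ((varList u).flatMap fun x => .var :: encodeNumber x) <+ encodeTerm u := by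
  induction u with
  | var x => simp [varList, encodeTerm]
  | app f ts ih =>
    rw [varList, encodeTerm, List.flatMap_assoc, encodeFamily_eq]
    exact ((flatMap_sublist ih _).trans (List.sublist_append_right _ _)).trans
      (List.sublist_append_left _ _)

theorem ruleVars_sublist (ρ : Rule S) :
    ((ruleVars ρ).flatMap fun x => .var :: encodeNumber x) <+ encodeRule ρ := by
  rw [ruleVars, List.flatMap_append, encodeRule, List.append_assoc]
  exact (varList_sublist _).append
    (((varList_sublist _).cons _).trans (List.sublist_append_left _ _))

theorem trsVars_sublist (x : Input) :
    ((x.trs.flatMap ruleVars).flatMap fun y => .var :: encodeNumber y) <+ x.encode := by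
  rw [List.flatMap_assoc, Input.encode, ← List.flatMap_def]
  exact ((flatMap_sublist ruleVars_sublist _).cons _).trans (List.sublist_append_right _ _)

theorem length_le_length_flatMap {ι α : Type} {g : ι → List α} {l : List ι} {i : ι} (h : i ∈ l) :
    (g i).length ≤ (l.flatMap g).length := by
  obtain ⟨l₁, l₂, rfl⟩ := List.append_of_mem h
  simp only [List.flatMap_append, List.flatMap_cons, List.length_append]
  omega

theorem length_flatMap_le {ι α β : Type} {g : ι → List α} {h : ι → List β} {C : ℕ}
    (hgh : ∀ i, (g i).length ≤ C * (h i).length) (l : List ι) :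
    (l.flatMap g).length ≤ C * (l.flatMap h).length := by
  induction l with
  | nil => simp
  | cons i l ih =>
    rw [List.flatMap_cons, List.flatMap_cons, List.length_append, List.length_append, mul_add]
    exact Nat.add_le_add (hgh i) ih

theorem length_bits_le_length_encode (x : Input) (q : Fin x.numStates) :
    (q : ℕ).bits.length ≤ x.encode.length := by
  have h := length_le_length_flatMap (g := fun q => encodeState q ++
    if x.aut.accepting q then [.accept] else []) (List.mem_finRange q)
  rw [← encodeFamily_eq] at h
  simp only [List.length_append, encodeState, List.length_cons, encodeNumber, List.length_map] at h
  simp only [Input.encode, List.length_append, List.length_cons, encodeStates, encodeState]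
  simp only [encodeNumber] at h ⊢
  omega

/-- The block of a certificate that assigns the state `q` to the variable `x`. -/
def certificateEntry (x q : Name) : List Bool :=
  (x.reverse.flatMap fun b => [true, b]) ++ [false, false] ++
    (q.reverse.flatMap fun b => [true, b]) ++ [false, true]

theorem length_certificateEntry (x q : Name) :
    (certificateEntry x q).length = 2 * x.length + 2 * q.length + 4 := by
  simp [certificateEntry]
  omega

theorem foldl_certificateStep_bits (u cur x : Name) (τ : Assignment) :
    (u.reverse.flatMap fun b => [true, b]).foldl certificateStep ([], cur, x, τ) =
      ([], u ++ cur, x, τ) := by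
  induction u generalizing cur with
  | nil => rfl
  | cons b u ih =>
    rw [List.reverse_cons, List.flatMap_append, List.foldl_append, ih]
    rfl

theorem foldl_certificateEntry (x q : Name) (τ : Assignment) :
    (certificateEntry x q).foldl certificateStep ([], [], [], τ) = ([], [], [], (x, q) :: τ) := by
  rw [certificateEntry, List.foldl_append, List.foldl_append, List.foldl_append,
    foldl_certificateStep_bits]
  change List.foldl certificateStep (List.foldl certificateStep ([], [], x ++ [], τ) _) _ = _
  rw [foldl_certificateStep_bits, List.append_nil, List.append_nil]
  rfl

theorem readCertificate_flatMap (τ : Assignment) :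
    readCertificate (τ.flatMap fun e => certificateEntry e.1 e.2) = τ.reverse := by
  have key : ∀ τ τ' : Assignment, (τ.flatMap fun e => certificateEntry e.1 e.2).foldl
      certificateStep ([], [], [], τ') = ([], [], [], τ.reverse ++ τ') := by
    intro τ
    induction τ with
    | nil => intro τ'; rfl
    | cons e τ ih =>
      intro τ'
      rw [List.flatMap_cons, List.foldl_append, foldl_certificateEntry, ih, List.reverse_cons,
        List.append_assoc]
      rfl
  rw [readCertificate, key, List.append_nil]

/-- Every assignment of states to the variables of the rules has a certificate of polynomial length:
the blocks of the certificate are charged to the occurrences of variables in the input. -/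
theorem exists_certificate (x : Input) (v : ℕ → Fin x.numStates) :
    ∃ w : List Bool, w.length ≤ (2 * x.encode.length + 4) * x.encode.length ∧
      Covers x.trs v (readCertificate w) := by
  refine ⟨((x.trs.flatMap ruleVars).map fun y =>
    ((y.bits, (v y : ℕ).bits) : Name × Name)).flatMap fun e => certificateEntry e.1 e.2, ?_, ?_, ?_⟩
  · rw [List.flatMap_map]
    refine (length_flatMap_le (h := fun y => .var :: encodeNumber y) (fun y => ?_) _).trans
      (Nat.mul_le_mul_left _ (trsVars_sublist x).length_le)
    have h := length_bits_le_length_encode x (v y)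
    rw [length_certificateEntry, List.length_cons, encodeNumber, List.length_map]
    nlinarith [Nat.zero_le (x.encode.length * y.bits.length)]
  · intro e he
    rw [readCertificate_flatMap, List.mem_reverse, List.mem_map] at he
    obtain ⟨y, -, rfl⟩ := he
    exact ⟨y, rfl⟩
  · intro ρ hρ y hy
    rw [readCertificate_flatMap, List.mem_reverse, List.mem_map]
    refine ⟨y, List.mem_flatMap.2 ⟨ρ, hρ, List.mem_append.2 ?_⟩, rfl⟩
    exact hy.imp mem_varList mem_varList

/-! ### Assignments to boundedly many variables -/

theorem exists_mem_assignments (v : ℕ → Fin n) (N : ℕ) :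
    ∃ τ ∈ assignments N ((List.finRange n).map fun q : Fin n => (q : ℕ).bits),
      (∀ e ∈ τ, ∃ x : ℕ, e = (x.bits, (v x : ℕ).bits)) ∧
        ∀ x < N, ((x.bits, (v x : ℕ).bits) : Name × Name) ∈ τ := by
  induction N with
  | zero => exact ⟨[], List.mem_singleton.2 rfl, by simp, by simp⟩
  | succ N ih =>
    obtain ⟨τ, hτ, h₁, h₂⟩ := ih
    refine ⟨(N.bits, (v N : ℕ).bits) :: τ, ?_, ?_, fun x hx => ?_⟩
    · exact List.mem_flatMap.2 ⟨τ, hτ, List.mem_map.2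
        ⟨_, List.mem_map.2 ⟨v N, List.mem_finRange _, rfl⟩, rfl⟩⟩
    · intro e he
      rcases List.mem_cons.1 he with rfl | he
      · exact ⟨N, rfl⟩
      · exact h₁ e he
    · rcases Nat.lt_succ_iff_lt_or_eq.1 hx with hx | rfl
      · exact List.mem_cons_of_mem _ (h₂ x hx)
      · exact List.mem_cons_self

/-! ### Correctness of the two algorithms -/

theorem inconsistentBounded_iff {N : ℕ} {x : Input} (hx : x.VarsBounded N) :
    inconsistentBounded N x.encode = true ↔ ¬ x.IsConsistent := by
  rw [inconsistentBounded, inputSection_one, inputSection_two, inputSection_three,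
    distinguishes_iff]
  constructor
  · rintro ⟨p, q, hd, hpq⟩
    exact not_consistent_of_derives hd hpq
  · intro h
    obtain ⟨v, -, hv⟩ := exists_derives_of_not_consistent h
    obtain ⟨τ, hτ, h₁, h₂⟩ := exists_mem_assignments v N
    rw [← stateNames_stateTokens x.aut] at hτ
    exact hv _ ⟨τ, hτ, h₁, fun ρ hρ y hy => h₂ y
      (hy.elim (fun h => (hx ρ hρ).1 h) fun h => (hx ρ hρ).2 h)⟩

theorem verify_encodeWithCertificate (x : Input) (w : List Bool) :
    verify (encodeWithCertificate Input.encode (x, w)) = true ↔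
      ∃ p q, Derives x.aut x.trs {τ | τ ∈ [readCertificate w]} p q ∧
        x.aut.accepting p ≠ x.aut.accepting q := by
  have h₁ : ((encodeWithCertificate Input.encode (x, w)).filter fun a => !a.isRight).map asLetter =
      x.encode := by
    simp [encodeWithCertificate, List.filter_append, List.filter_map, Function.comp_def, asLetter]
  have h₂ : ((encodeWithCertificate Input.encode (x, w)).filter Sum.isRight).map
      (fun a => bitValue (asLetter a)) = w := by
    simp [encodeWithCertificate, List.filter_append, List.filter_map, Function.comp_def, asLetter,
      bitValue, letterCode]
  rw [← distinguishes_iff, ← inputSection_one, ← inputSection_two, ← inputSection_three, verify]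
  simp only [h₁, h₂]

end TreeRewriting

theorem mainTheorem6 :
    TreeRewriting.InCoNP TreeRewriting.Input.encode TreeRewriting.Input.IsConsistent ∧
    ∀ N : ℕ, 0 < N →
      TreeRewriting.InP
        (fun x : {x : TreeRewriting.Input // x.VarsBounded N} => x.1.encode)
        (fun x => x.1.IsConsistent) := by
  open TreeRewriting in
  refine ⟨⟨fun a => verify (encodeWithCertificate Input.encode a),
    (2 * Polynomial.X + 4) * Polynomial.X, fp_verify.polyTime _, fun x => ⟨fun h => ?_, ?_⟩⟩,
    fun N _ => ⟨fun x => !inconsistentBounded N x.1.encode,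
      (FP.not (fp_inconsistentBounded N)).polyTime _, fun x => ?_⟩⟩
  · obtain ⟨v, -, hv⟩ := exists_derives_of_not_consistent h
    obtain ⟨w, hw, hc⟩ := exists_certificate x v
    refine ⟨w, by simpa using hw, (verify_encodeWithCertificate x w).2 ?_⟩
    exact hv _ ⟨_, List.mem_singleton.2 rfl, hc⟩
  · rintro ⟨w, -, hw⟩
    obtain ⟨p, q, hd, hpq⟩ := (verify_encodeWithCertificate x w).1 hw
    exact not_consistent_of_derives hd hpq
  · rw [Bool.not_eq_true', ← Bool.not_eq_true, inconsistentBounded_iff x.2, not_not]
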